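/- For integers $n\ge 0$ let $\int_{n\swarrow n+1}$ and $\int_{n\searrow n+1}$ denote integration over $\mathbb{R}$ along the straight line through $n+\tfrac12$ in the direction $e^{5\pi i/4}$, respectively $e^{-\pi i/4}$. All powers and logarithms are principal. Let $$\mathcal{R}(s)=\int_{0\swarrow 1}\frac{x^{-s}e^{\pi i x^2}}{e^{\pi i x}-e^{-\pi i x}}\,dx$$ be Riemann's auxiliary function, and let $\chi(s)=2^s\pi^{s-1}\sin\bigl(\tfrac{\pi s}{2}\bigr)\Gamma(1-s)$ be the factor in the functional equation $\zeta(s)=\chi(s)\zeta(1-s)$. **Theorem.** Let $s\in\mathbb{C}$ with $0<\arg(s-1)<2\pi$ (that is, $s\notin[1,\infty)$). Let $$\eta:=\sqrt{\frac{s-1}{2\pi i}},\quad -\frac{\pi}{4}<\arg\eta<\frac{3\pi}{4},\quad \eta_1:=\Re\eta,\quad \eta_2:=\Im\eta,\quad m:=\lfloor\eta_1+\eta_2\rfloor,$$ $$w(z):=\exp\Bigl\{2\pi i\eta^2\Bigl(\log\Bigl(1+\frac z\eta\Bigr)-\frac z\eta+\frac12\Bigl(\frac z\eta\Bigr)^2\Bigr)\Bigr\}-1.$$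 Then for each integer $k\ge m$ we have $$\mathcal{R}(s)=\chi(s)\Bigl\{\zeta(1-s)-\sum_{n=1}^{k}n^{s-1}-\eta^{s-1}e^{-\pi i\eta^2}\Bigl[\frac{\sqrt2\,e^{3\pi i/8}\sin\pi\eta-(-1)^k e^{2\pi i\eta-2\pi i(\eta-k)^2}}{2\cos 2\pi\eta}+\sum_{j=m+1}^{k}(-1)^{j-1}e^{-2\pi i(j-\eta)^2}w(j-\eta)+R\Bigr]\Bigr\},$$ where $$R:=\int_{m\searrow m+1}\frac{e^{-2\pi i(x-\eta)^2}}{e^{\pi i x}-e^{-\pi i x}}\,w(x-\eta)\,dx .$$ The integrals defining $\mathcal{R}(s)$ and $R$ converge absolutely. The quotient with denominator $2\cos 2\pi\eta$ has only removable singularities as a function of $\eta$; where $\cos 2\pi\eta=0$ it is replaced by its limit. At $s=0$, where $\zeta(1-s)$ has a pole and $\chi$ a zero, the formula is read as a limit: $\chi(z)\{\zeta(1-z)-\dots\}\to\mathcal{R}(0)$ as $z\to0$, $z\ne 0$, where "$\dots$" stands for the remaining terms, evaluated at $s=0$. -/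

import Mathlib

open Complex Filter MeasureTheory
open scoped Topology

noncomputable section

/-- The integrand of the complex line integral of `f` along `u ↦ a + u d`, `u` running over `ℝ`. -/
def lineIntegrand (f : ℂ → ℂ) (a d : ℂ) (u : ℝ) : ℂ :=
  f (a + (u : ℂ) * d) * d

/-- The integral of `f` along the straight line through `a` with direction `d`,
run through in the direction `d`. -/
def lineIntegral (f : ℂ → ℂ) (a d : ℂ) : ℂ :=
  ∫ u : ℝ, lineIntegrand f a d u

/-- The direction of a path `n ↙ n+1`: from the upper right to the lower left. -/
def dirSW : ℂ := exp (5 * Real.pi * Complex.I / 4)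

/-- The direction of a path `n ↘ n+1`: from the upper left to the lower right. -/
def dirSE : ℂ := exp (-(Real.pi * Complex.I / 4))

/-- The integrand `x^{-s} e^{π i x²} / (e^{π i x} - e^{-π i x})`, principal branch of `x^{-s}`. -/
def auxIntegrand (s x : ℂ) : ℂ :=
  x ^ (-s) * exp (Real.pi * Complex.I * x ^ 2) / (exp (Real.pi * Complex.I * x) - exp (-(Real.pi * Complex.I * x)))

/-- Riemann's auxiliary function, the integral of `auxIntegrand s` along `0 ↙ 1`. -/
def riemannAux (s : ℂ) : ℂ :=
  lineIntegral (auxIntegrand s) (1 / 2) dirSW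

/-- The factor `χ(s)` of the functional equation `ζ(s) = χ(s) ζ(1-s)`. -/
def chiFactor (s : ℂ) : ℂ :=
  2 ^ s * (Real.pi : ℂ) ^ (s - 1) * sin (Real.pi * s / 2) * Gamma (1 - s)

/-- `w(z) = exp{2π i η² (log(1 + z/η) - z/η + (z/η)²/2)} - 1`, principal logarithm. -/
def wFun (η z : ℂ) : ℂ :=
  exp (2 * Real.pi * Complex.I * η ^ 2 * (log (1 + z / η) - z / η + 1 / 2 * (z / η) ^ 2)) - 1

/-- The quotient
`(√2 e^{3π i/8} sin πη - (-1)^k e^{2π i η - 2π i (η-k)²}) / (2 cos 2πη)`. -/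
def riemannQuot (k : ℤ) (η : ℂ) : ℂ :=
  ((Real.sqrt 2 : ℂ) * exp (3 * Real.pi * Complex.I / 8) * sin (Real.pi * η)
      - (-1) ^ k * exp (2 * Real.pi * Complex.I * η - 2 * Real.pi * Complex.I * (η - k) ^ 2))
    / (2 * cos (2 * Real.pi * η))

/-- `riemannQuot k` with its removable singularities (the zeros of `cos 2πη`) removed. -/
def riemannTerm (k : ℤ) (η : ℂ) : ℂ :=
  limUnder (𝓝[≠] η) (riemannQuot k)

/-- Away from the zeros of the denominator, `riemannTerm` is the quotient itself. -/
theorem riemannTerm_eq_quot (k : ℤ) (η : ℂ) (h : cos (2 * Real.pi * η) ≠ 0) :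
    riemannTerm k η = riemannQuot k η := by
  have hc : ContinuousAt (riemannQuot k) η := by
    unfold riemannQuot
    refine ContinuousAt.div (by fun_prop) (by fun_prop) ?_
    exact mul_ne_zero two_ne_zero h
  exact (hc.tendsto.mono_left nhdsWithin_le_nhds).limUnder_eq

/-- The integrand `e^{-2π i (x-η)²} w(x-η) / (e^{π i x} - e^{-π i x})` of the remainder. -/
def remIntegrand (η x : ℂ) : ℂ :=
  exp (-(2 * Real.pi * Complex.I * (x - η) ^ 2))
    / (exp (Real.pi * Complex.I * x) - exp (-(Real.pi * Complex.I * x))) * wFun η (x - η)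

/-- The remainder `R`, the integral of `remIntegrand η` along `m ↘ m+1`. -/
def remainderR (η : ℂ) (m : ℤ) : ℂ :=
  lineIntegral (remIntegrand η) (m + 1 / 2) dirSE

/-- `∑_{n=1}^k n^{s-1} + η^{s-1} e^{-π i η²} [riemannTerm k η +
∑_{j=m+1}^k (-1)^{j-1} e^{-2π i (j-η)²} w(j-η) + R ]`, the part of the formula that is
subtracted from `ζ(1-s)`. -/
def siegelPart (s η : ℂ) (m k : ℤ) : ℂ :=
  ∑ n ∈ Finset.Icc 1 k, (n : ℂ) ^ (s - 1)
    + η ^ (s - 1) * exp (-(Real.pi * Complex.I * η ^ 2)) *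
      (riemannTerm k η
        + ∑ j ∈ Finset.Icc (m + 1) k,
            (-1) ^ (j - 1) * exp (-(2 * Real.pi * Complex.I * ((j : ℂ) - η) ^ 2)) * wFun η ((j : ℂ) - η)
        + remainderR η m)

end

noncomputable section

/-! ### Gaussian domination and horizontal contour shifts -/

/-! Let D(s) be the reflected integral of x^{s-1} e^{-πix²} / (e^{πix} - e^{-πix}) along 0 ↘ 1
(`dualAux`). Two facts give the theorem: Riemann's identity R(s) = ζ(s) - χ(s) D(s), with R(s) the
auxiliary function, and an exact expansion of D(s) about η, a saddle point of x^{s-1} e^{-πix²}.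

Riemann's identity. For Re s < -1 the path of the auxiliary function moves to the line through the
origin (`integrable_and_riemannAux_eq`), whose two rays combine into one Mellin integral of e^{πip²}
/ (e^{πip} - e^{-πip}) over arg p = π/4. The Gaussian integral `gaussSine 1 p` satisfies two
difference equations in p; solving them writes that quotient as `gaussSine 1 p` minus 1 / (e^{-2πip}
- 1) (`gaussSine_one_eq`). By Fubini and the Gamma integral the first has Mellin transform a
multiple of Γ(1-s) D(s); expanded geometrically, the second has the same multiple of Γ(1-s) ζ(1-s).
This is `riemannAux_eq_of_re_lt`; analytic continuation extends it to the plane cut along [1,∞)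
(`riemannAux_eq_zeta_sub`).

The expansion. Moving the path of D to m ↘ m+1 collects the terms n^{s-1}, n ≤ m. On the new path
the numerator is exactly η^{s-1} e^{-πiη²} e^{-2πi(x-η)²} (1 + w(x-η)) (`cpow_mul_gauss_eq`). The
part with w is the remainder; the other part is a Gaussian integral which the same difference
equations, now with α = 2, evaluate as the cosine quotient (`two_cos_mul_gaussSine_two`). Raising k
moves only the Gaussian integral past further integers, and the terms w(j-η) are the discrepancy
between the full and the Gaussian residues (`siegelPart_eq_dualAux`).

Poles are crossed without a residue theorem: subtracting a multiple of one Gaussian makes the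
singularity removable, and the jump of that Gaussian is known by symmetry (`gaussSine_one_zero`,
`lineIntegral_sub_eq_apply_zero`). -/

theorem integrable_exp_mul_abs_sub_sq (B : ℝ) :
    Integrable fun u : ℝ => Real.exp (B * |u| - u ^ 2) := by
  have h : ∀ c : ℝ, Integrable fun u : ℝ => Real.exp (c * u - u ^ 2) := fun c => by
    have h1 := ((integrable_exp_neg_mul_sq (b := 1) one_pos).comp_sub_right (c / 2)).const_mul
      (Real.exp (c ^ 2 / 4))
    refine h1.congr (Eventually.of_forall fun u => ?_)
    simp only [← Real.exp_add]
    congr 1; ring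
  refine ((h B).add (h (-B))).mono' (by fun_prop) (Eventually.of_forall fun u => ?_)
  rw [Real.norm_eq_abs, abs_of_pos (Real.exp_pos _)]
  simp only [Pi.add_apply]
  rcases abs_cases u with ⟨hu, _⟩ | ⟨hu, _⟩ <;> rw [hu]
  · linarith [Real.exp_pos (-B * u - u ^ 2)]
  · rw [mul_neg, ← neg_mul]; linarith [Real.exp_pos (B * u - u ^ 2)]

theorem tendsto_exp_mul_abs_sub_sq (B : ℝ) :
    Tendsto (fun T : ℝ => Real.exp (B * |T| - T ^ 2)) atTop (𝓝 0) := by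
  refine Real.tendsto_exp_atBot.comp ?_
  refine tendsto_atBot_mono' atTop (f₁ := fun T : ℝ => -T) ?_ tendsto_neg_atTop_atBot
  filter_upwards [eventually_ge_atTop (max 0 (B + 1))] with T hT
  have h0 : 0 ≤ T := (le_max_left _ _).trans hT
  have h1 : B + 1 ≤ T := (le_max_right _ _).trans hT
  rw [abs_of_nonneg h0]; nlinarith

/-- `h` is bounded by a constant times `e^{B|u| - u²}`. -/
def GaussDom (h : ℝ → ℂ) : Prop := ∃ C B : ℝ, ∀ u, ‖h u‖ ≤ C * Real.exp (B * |u| - u ^ 2)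

theorem GaussDom.integrable {h : ℝ → ℂ} (hh : GaussDom h) (hm : AEStronglyMeasurable h) :
    Integrable h := by
  obtain ⟨C, B, hb⟩ := hh
  exact ((integrable_exp_mul_abs_sub_sq B).const_mul C).mono' hm (Eventually.of_forall hb)

/-- The integral of `F` along the horizontal line at height `y`. -/
def horizontalIntegral (F : ℂ → ℂ) (y : ℝ) : ℂ := ∫ u : ℝ, F (u + y * I)

/-- Cauchy's theorem on the rectangles |Re z| ≤ T, where the Gaussian bound kills the vertical sides
as T → ∞. Mere continuity on the edges leaves room for a branch point there, as needed when the path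
of `riemannAux` is moved to the origin. -/
theorem horizontalIntegral_eq_of_differentiableOn {F : ℂ → ℂ} {a b : ℝ} (hab : a ≤ b)
    (hc : ContinuousOn F {z | a ≤ z.im ∧ z.im ≤ b})
    (hd : DifferentiableOn ℂ F {z | a < z.im ∧ z.im < b})
    {C B T₀ : ℝ} (hB : ∀ z : ℂ, a ≤ z.im → z.im ≤ b → T₀ ≤ |z.re| →
      ‖F z‖ ≤ C * Real.exp (B * |z.re| - z.re ^ 2))
    (hia : Integrable fun u : ℝ => F (u + a * I))
    (hib : Integrable fun u : ℝ => F (u + b * I)) :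
    horizontalIntegral F a = horizontalIntegral F b := by
  have ha := intervalIntegral_tendsto_integral hia tendsto_neg_atTop_atBot tendsto_id
  have hb := intervalIntegral_tendsto_integral hib tendsto_neg_atTop_atBot tendsto_id
  -- The sign σ = ±1 treats the right and left vertical sides together.
  have side : ∀ σ : ℝ, |σ| = 1 → Tendsto (fun T : ℝ =>
      I • ∫ y in a..b, F ((σ * T : ℝ) + y * I)) atTop (𝓝 0) := by
    intro σ hσ
    have h1 : Tendsto (fun T : ℝ => C * Real.exp (B * |T| - T ^ 2) * |b - a|) atTop (𝓝 0) := by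
      simpa using ((tendsto_exp_mul_abs_sub_sq B).const_mul C).mul_const |b - a|
    refine squeeze_zero_norm' ?_ h1
    filter_upwards [eventually_ge_atTop (max T₀ 0)] with T hT
    have h0 : 0 ≤ T := (le_max_right _ _).trans hT
    rw [norm_smul, norm_I, one_mul]
    refine intervalIntegral.norm_integral_le_of_norm_le_const fun y hy => ?_
    rw [Set.uIoc_of_le hab] at hy
    have h2 : ((σ * T : ℝ) + y * I : ℂ).re = σ * T := by simp
    have h3 : ((σ * T : ℝ) + y * I : ℂ).im = y := by simp
    have h4 : |σ * T| = T := by rw [abs_mul, hσ, one_mul, abs_of_nonneg h0]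
    have h5 := hB ((σ * T : ℝ) + y * I) (by rw [h3]; exact hy.1.le) (by rw [h3]; exact hy.2)
      (by rw [h2, h4]; exact (le_max_left _ _).trans hT)
    rw [h2, h4, ← sq_abs, h4] at h5
    rwa [abs_of_nonneg h0]
  have key : ∀ T : ℝ, (∫ u in (-T)..T, F (u + a * I)) - (∫ u in (-T)..T, F (u + b * I))
      + (I • ∫ y in a..b, F ((1 * T : ℝ) + y * I))
      - (I • ∫ y in a..b, F (((-1) * T : ℝ) + y * I)) = 0 := by
    intro T
    have := Complex.integral_boundary_rect_eq_zero_of_continuousOn_of_differentiableOn F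
      (-T + a * I) (T + b * I) (hc.mono ?_) (hd.mono ?_)
    · simpa using this
    · intro z hz
      have := hz.2
      simpa [Set.uIcc_of_le hab] using this
    · intro z hz
      have := hz.2
      simpa [hab] using this
  have lim := ((ha.sub hb).add (side 1 (by simp))).sub (side (-1) (by simp))
  have h0 : Tendsto (fun _ : ℝ => (0 : ℂ)) atTop (𝓝 0) := tendsto_const_nhds
  have := tendsto_nhds_unique (lim.congr key) h0
  simp only [add_zero, sub_zero] at this
  exact sub_eq_zero.1 this

/-! ### The denominator -/

/-- `e^{π i x} - e^{-π i x}`. -/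
def expDiff (x : ℂ) : ℂ := exp (Real.pi * I * x) - exp (-(Real.pi * I * x))

theorem expDiff_eq_sin (x : ℂ) : expDiff x = 2 * I * sin (Real.pi * x) := by
  rw [expDiff, Complex.sin]
  have : exp (Real.pi * I * x) = exp (Real.pi * x * I) := by ring_nf
  have h2 : exp (-(Real.pi * I * x)) = exp (-(Real.pi * x) * I) := by ring_nf
  rw [this, h2]
  linear_combination (exp (Real.pi * x * I) - exp (-(Real.pi * x) * I)) * I_sq

@[fun_prop] theorem differentiable_expDiff : Differentiable ℂ expDiff := by
  unfold expDiff; fun_prop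

@[fun_prop] theorem continuous_expDiff : Continuous expDiff := differentiable_expDiff.continuous

theorem expDiff_neg (x : ℂ) : expDiff (-x) = -expDiff x := by
  simp [expDiff_eq_sin]

theorem expDiff_add_intCast (x : ℂ) (n : ℤ) : expDiff (x + n) = (-1) ^ n * expDiff x := by
  simp only [expDiff_eq_sin, mul_add]
  rw [show (Real.pi : ℂ) * n = n * Real.pi by ring, Complex.sin_antiperiodic.add_int_mul_eq]
  rcases n.even_or_odd with h | h
  · simp [Int.negOnePow_even _ h, h.neg_one_zpow]
  · simp [Int.negOnePow_odd _ h, h.neg_one_zpow]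

theorem expDiff_eq_zero_iff {x : ℂ} : expDiff x = 0 ↔ ∃ n : ℤ, x = n := by
  have hp : (Real.pi : ℂ) ≠ 0 := by exact_mod_cast Real.pi_ne_zero
  rw [expDiff_eq_sin, mul_eq_zero, or_iff_right (by simp), Complex.sin_eq_zero_iff]
  refine exists_congr fun n => ?_
  rw [mul_comm, mul_left_inj' hp]

theorem one_le_norm_expDiff {x : ℂ} (hx : 1 ≤ |x.im|) : 1 ≤ ‖expDiff x‖ := by
  have key : ∀ y : ℂ, 1 ≤ y.im → 1 ≤ ‖expDiff y‖ := by
    intro y hy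
    have h1 : ‖exp (-(Real.pi * I * y))‖ = Real.exp (Real.pi * y.im) := by
      rw [Complex.norm_exp]; simp
    have h2 : ‖exp (Real.pi * I * y)‖ = Real.exp (-(Real.pi * y.im)) := by
      rw [Complex.norm_exp]; simp
    have h3 := norm_sub_norm_le (exp (-(Real.pi * I * y))) (exp (Real.pi * I * y))
    rw [norm_sub_rev, h1, h2] at h3
    have h4 := Real.pi_gt_three
    have h5 := Real.add_one_le_exp (Real.pi * y.im)
    have h6 : Real.exp (-(Real.pi * y.im)) ≤ 1 := Real.exp_le_one_iff.2 (by nlinarith)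
    have : ‖expDiff y‖ = ‖exp (Real.pi * I * y) - exp (-(Real.pi * I * y))‖ := rfl
    nlinarith
  rcases le_abs.1 hx with h | h
  · exact key x h
  · rw [← norm_neg, ← expDiff_neg]; exact key (-x) (by simpa using h)

/-- With πt = a + bi the modulus is 2|cos πt|, and |cos πt|² = cos² a + sinh² b ≥ cos² a + b² ≥ cos²
a + a² ≥ 1. Both diagonal directions satisfy the hypothesis, so on every path used the denominator
can simply be dropped from upper bounds. -/
theorem two_le_norm_expDiff_half {t : ℂ} (ht : |t.re| ≤ |t.im|) (n : ℤ) :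
    2 ≤ ‖expDiff (n + 1 / 2 + t)‖ := by
  have h1 : expDiff (n + 1 / 2 + t) = (-1) ^ n * (2 * I * cos (Real.pi * t)) := by
    rw [show (n + 1 / 2 + t : ℂ) = (1 / 2 + t) + n by ring, expDiff_add_intCast, expDiff_eq_sin,
      show (Real.pi : ℂ) * (1 / 2 + t) = Real.pi * t + Real.pi / 2 by ring,
      Complex.sin_add_pi_div_two]
  have h2 : ‖expDiff (n + 1 / 2 + t)‖ = 2 * ‖cos (Real.pi * t)‖ := by
    rw [h1]; simp [norm_zpow]
  rw [h2]
  suffices 1 ≤ ‖cos (Real.pi * t)‖ by linarith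
  set a := Real.pi * t.re with ha
  set b := Real.pi * t.im with hb
  have hab : a ^ 2 ≤ b ^ 2 := by
    rw [ha, hb, mul_pow, mul_pow]
    exact mul_le_mul_of_nonneg_left (sq_le_sq.2 ht) (sq_nonneg _)
  have h3 : (Real.pi : ℂ) * t = a + b * I := by
    rw [ha, hb]; apply Complex.ext <;> simp
  have h4 : Complex.normSq (cos (Real.pi * t)) = Real.cos a ^ 2 + Real.sinh b ^ 2 := by
    rw [h3, Complex.cos_add_mul_I, ← ofReal_cos, ← ofReal_sin, ← ofReal_cosh, ← ofReal_sinh,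
      Complex.normSq_apply]
    simp only [sub_re, mul_re, ofReal_re, ofReal_im, I_re, I_im, sub_im, mul_im]
    linear_combination (Real.cos a ^ 2) * Real.cosh_sq b + Real.sinh b ^ 2 * Real.sin_sq_add_cos_sq a
  have h5 : b ^ 2 ≤ Real.sinh b ^ 2 := by
    rw [sq_le_sq, Real.abs_sinh]
    exact Real.self_le_sinh_iff.2 (abs_nonneg b)
  have h6 : 1 ≤ ‖cos (Real.pi * t)‖ ^ 2 := by
    rw [← Complex.normSq_eq_norm_sq, h4]
    have := Real.sin_sq_le_sq (x := a)
    nlinarith [Real.sin_sq_add_cos_sq a]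
  exact (one_le_sq_iff₀ (norm_nonneg _)).1 h6

/-! ### The Gamma integral with a complex rate -/

/-- The Gamma integral with a complex rate. -/
theorem integral_cpow_mul_exp_neg_complex_mul_Ioi {a r : ℂ} (ha : 0 < a.re) (hr : 0 < r.re) :
    ∫ t : ℝ in Set.Ioi 0, (t : ℂ) ^ (a - 1) * exp (-(r * t)) = r ^ (-a) * Gamma a := by
  set F : ℂ → ℂ := fun r => ∫ t : ℝ in Set.Ioi 0, (t : ℂ) ^ (a - 1) * exp (-(r * t)) with hF
  set G : ℂ → ℂ := fun r => r ^ (-a) * Gamma a with hG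
  set U : Set ℂ := {z | 0 < z.re} with hU
  have hUo : IsOpen U := isOpen_lt continuous_const continuous_re
  have hmeas : ∀ (b z : ℂ), AEStronglyMeasurable (fun t : ℝ => (t : ℂ) ^ b * exp (-(z * t)))
      (volume.restrict (Set.Ioi 0)) := fun b z => by
    refine ContinuousOn.aestronglyMeasurable (fun t ht => ContinuousAt.continuousWithinAt ?_)
      measurableSet_Ioi
    exact ((continuousAt_ofReal_cpow_const _ _ (Or.inr (ne_of_gt ht)))).mul (by fun_prop)
  have hnorm : ∀ (b z : ℂ) (t : ℝ), 0 < t →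
      ‖(t : ℂ) ^ b * exp (-(z * t))‖ = t ^ b.re * Real.exp (-z.re * t) := fun b z t ht => by
    rw [norm_mul, Complex.norm_cpow_eq_rpow_re_of_pos ht, Complex.norm_exp]; simp
  have hint : ∀ (b : ℂ) (c : ℝ), -1 < b.re → 0 < c →
      IntegrableOn (fun t : ℝ => t ^ b.re * Real.exp (-c * t)) (Set.Ioi 0) := fun b c hb hc => by
    simpa using integrableOn_rpow_mul_exp_neg_mul_rpow (s := b.re) (p := 1) hb one_pos hc
  have hdF : DifferentiableOn ℂ F U := by
    intro z hz
    have hz2 : 0 < z.re / 2 := half_pos hz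
    have hs : {w : ℂ | z.re / 2 < w.re} ∈ 𝓝 z :=
      (isOpen_lt continuous_const continuous_re).mem_nhds (show z.re / 2 < z.re from half_lt_self hz)
    refine (hasDerivAt_integral_of_dominated_loc_of_deriv_le (F := fun r (t : ℝ) =>
      (t : ℂ) ^ (a - 1) * exp (-(r * t))) (F' := fun r (t : ℝ) => (t : ℂ) ^ a * -exp (-(r * t)))
      (bound := fun t => t ^ a.re * Real.exp (-(z.re / 2) * t)) hs
      (Eventually.of_forall fun w => hmeas _ _) ?_ ?_ ?_ (hint a _ (by linarith) hz2)
      ?_).2.differentiableAt.differentiableWithinAt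
    · refine (hint (a - 1) z.re (by simpa using ha) hz).mono' (hmeas _ _) ?_
      filter_upwards [ae_restrict_mem measurableSet_Ioi] with t ht
      exact (hnorm _ _ _ ht).le
    · exact (hmeas a z).neg.congr (Eventually.of_forall fun t => by simp)
    · filter_upwards [ae_restrict_mem measurableSet_Ioi] with t ht w hw
      rw [mul_neg, norm_neg, hnorm _ _ _ ht]
      have ht0 : (0 : ℝ) < t := ht
      refine mul_le_mul_of_nonneg_left (Real.exp_le_exp.2 ?_) (Real.rpow_nonneg ht0.le _)
      have : z.re / 2 < w.re := hw
      nlinarith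
    · filter_upwards [ae_restrict_mem measurableSet_Ioi] with t ht w hw
      have ht0 : (t : ℂ) ≠ 0 := by exact_mod_cast (ne_of_gt ht)
      have h1 : HasDerivAt (fun r : ℂ => exp (-(r * t))) (exp (-(w * t)) * -(1 * t)) w :=
        (((hasDerivAt_id w).mul_const (t : ℂ)).neg).cexp
      refine (h1.const_mul ((t : ℂ) ^ (a - 1))).congr_deriv ?_
      rw [Complex.cpow_sub _ _ ht0, cpow_one]; field_simp
  have hdG : DifferentiableOn ℂ G U := fun z hz =>
    ((differentiableAt_id.cpow_const (Or.inl hz)).mul_const _).differentiableWithinAt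
  -- Both sides are holomorphic in the rate on the right half-plane and agree at real rates, which
  -- accumulate at 1; the identity theorem does the rest.
  have hreal : ∀ x : ℝ, 0 < x → F x = G x := fun x hx => by
    simp only [hF, hG]
    rw [Complex.integral_cpow_mul_exp_neg_mul_Ioi ha hx, cpow_neg, one_div, inv_cpow]
    rw [arg_ofReal_of_nonneg hx.le]; exact Real.pi_pos.ne
  have hfreq : ∃ᶠ z in 𝓝[≠] (1 : ℂ), F z = G z := by
    have ht : Tendsto (fun x : ℝ => (x : ℂ)) (𝓝[>] 1) (𝓝[≠] 1) := by
      refine tendsto_nhdsWithin_iff.2 ⟨?_, ?_⟩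
      · simpa using (continuous_ofReal.tendsto (1 : ℝ)).mono_left nhdsWithin_le_nhds
      · filter_upwards [self_mem_nhdsWithin] with x hx
        simpa using (ne_of_gt hx)
    refine ht.frequently (Eventually.frequently ?_)
    filter_upwards [self_mem_nhdsWithin] with x hx
    exact hreal x (zero_lt_one.trans hx)
  exact (hdF.analyticOnNhd hUo).eqOn_of_preconnected_of_frequently_eq (hdG.analyticOnNhd hUo)
    (convex_halfSpace_re_gt 0).isPreconnected (by simp [hU] : (1 : ℂ) ∈ U) hfreq hr

/-! ### The two directions -/

theorem dirSE_eq : dirSE = (Real.sqrt 2 / 2 : ℝ) * (1 - I) := by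
  rw [dirSE, show -(Real.pi * I / 4 : ℂ) = (-(Real.pi / 4) : ℝ) * I by push_cast; ring,
    exp_mul_I, ← ofReal_cos, ← ofReal_sin, Real.cos_neg, Real.sin_neg, Real.cos_pi_div_four,
    Real.sin_pi_div_four]
  push_cast; ring

theorem dirSW_eq : dirSW = -((Real.sqrt 2 / 2 : ℝ) * (1 + I)) := by
  rw [dirSW, show (5 * Real.pi * I / 4 : ℂ) = (Real.pi / 4 : ℝ) * I + Real.pi * I by
      push_cast; ring, Complex.exp_add, exp_pi_mul_I,
    exp_mul_I, ← ofReal_cos, ← ofReal_sin, Real.cos_pi_div_four,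
    Real.sin_pi_div_four]
  ring

theorem sqrt_two_div_two_sq : (Real.sqrt 2 / 2 : ℝ) ^ 2 = 1 / 2 := by
  rw [div_pow, Real.sq_sqrt (by norm_num)]; norm_num

theorem sqrt_two_div_two_sq' : ((Real.sqrt 2 / 2 : ℝ) : ℂ) ^ 2 = 1 / 2 := by
  rw [← ofReal_pow, sqrt_two_div_two_sq]; norm_num

theorem dirSE_sq : dirSE ^ 2 = -I := by
  rw [dirSE_eq, mul_pow, sqrt_two_div_two_sq']; linear_combination (1 / 2) * I_sq

theorem dirSE_re : dirSE.re = Real.sqrt 2 / 2 := by rw [dirSE_eq, re_ofReal_mul]; simp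
theorem dirSE_im : dirSE.im = -(Real.sqrt 2 / 2) := by rw [dirSE_eq, im_ofReal_mul]; simp
theorem dirSW_re : dirSW.re = -(Real.sqrt 2 / 2) := by
  rw [dirSW_eq, neg_re, re_ofReal_mul]; simp
theorem dirSW_im : dirSW.im = -(Real.sqrt 2 / 2) := by
  rw [dirSW_eq, neg_im, im_ofReal_mul]; simp

theorem norm_dirSE : ‖dirSE‖ = 1 := by
  rw [dirSE, Complex.norm_exp]; simp

theorem norm_dirSW : ‖dirSW‖ = 1 := by
  rw [dirSW, Complex.norm_exp]; simp

theorem dirSE_ne_zero : dirSE ≠ 0 := exp_ne_zero _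

theorem two_le_norm_expDiff_line {d : ℂ} (hd : d = dirSE ∨ d = dirSW) (n : ℤ) (u : ℝ) :
    2 ≤ ‖expDiff (n + 1 / 2 + u * d)‖ := by
  refine two_le_norm_expDiff_half ?_ n
  rw [re_ofReal_mul, im_ofReal_mul, abs_mul, abs_mul]
  rcases hd with rfl | rfl
  · rw [dirSE_re, dirSE_im, abs_neg]
  · rw [dirSW_re, dirSW_im]

/-! ### Gaussian domination in the plane -/

/-- `φ` is bounded on `S` by a constant times `e^{B|x| - |x|²}`. -/
def GaussDomOn (φ : ℂ → ℂ) (S : Set ℂ) : Prop :=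
  ∃ C B : ℝ, 0 ≤ C ∧ 0 ≤ B ∧ ∀ x ∈ S, ‖φ x‖ ≤ C * Real.exp (B * ‖x‖ - ‖x‖ ^ 2)

theorem GaussDomOn.mono {φ : ℂ → ℂ} {S T : Set ℂ} (h : GaussDomOn φ S) (hT : T ⊆ S) :
    GaussDomOn φ T := by
  obtain ⟨C, B, hC, hB, hb⟩ := h
  exact ⟨C, B, hC, hB, fun x hx => hb x (hT hx)⟩

theorem GaussDomOn.const_mul {φ : ℂ → ℂ} {S : Set ℂ} (h : GaussDomOn φ S) (c : ℂ) :
    GaussDomOn (fun x => c * φ x) S := by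
  obtain ⟨C, B, hC, hB, hb⟩ := h
  refine ⟨‖c‖ * C, B, by positivity, hB, fun x hx => ?_⟩
  rw [norm_mul, mul_assoc]
  exact mul_le_mul_of_nonneg_left (hb x hx) (norm_nonneg _)

theorem GaussDomOn.sub {φ ψ : ℂ → ℂ} {S : Set ℂ} (h : GaussDomOn φ S) (h' : GaussDomOn ψ S) :
    GaussDomOn (fun x => φ x - ψ x) S := by
  obtain ⟨C, B, hC, hB, hb⟩ := h
  obtain ⟨C', B', hC', hB', hb'⟩ := h'
  refine ⟨C + C', B + B', by positivity, by positivity, fun x hx => ?_⟩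
  have h1 : Real.exp (B * ‖x‖ - ‖x‖ ^ 2) ≤ Real.exp ((B + B') * ‖x‖ - ‖x‖ ^ 2) :=
    Real.exp_le_exp.2 (by nlinarith [norm_nonneg x, mul_nonneg hB' (norm_nonneg x)])
  have h2 : Real.exp (B' * ‖x‖ - ‖x‖ ^ 2) ≤ Real.exp ((B + B') * ‖x‖ - ‖x‖ ^ 2) :=
    Real.exp_le_exp.2 (by nlinarith [norm_nonneg x, mul_nonneg hB (norm_nonneg x)])
  calc ‖φ x - ψ x‖ ≤ ‖φ x‖ + ‖ψ x‖ := norm_sub_le _ _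
    _ ≤ C * Real.exp (B * ‖x‖ - ‖x‖ ^ 2) + C' * Real.exp (B' * ‖x‖ - ‖x‖ ^ 2) :=
      add_le_add (hb x hx) (hb' x hx)
    _ ≤ (C + C') * Real.exp ((B + B') * ‖x‖ - ‖x‖ ^ 2) := by
      rw [add_mul]
      exact add_le_add (mul_le_mul_of_nonneg_left h1 hC) (mul_le_mul_of_nonneg_left h2 hC')

theorem GaussDomOn.mul {φ ψ : ℂ → ℂ} {S : Set ℂ} (h : GaussDomOn φ S) {C' B' : ℝ}
    (hC' : 0 ≤ C') (hB' : 0 ≤ B') (hb' : ∀ x ∈ S, ‖ψ x‖ ≤ C' * Real.exp (B' * ‖x‖)) :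
    GaussDomOn (fun x => ψ x * φ x) S := by
  obtain ⟨C, B, hC, hB, hb⟩ := h
  refine ⟨C' * C, B + B', by positivity, by positivity, fun x hx => ?_⟩
  rw [norm_mul]
  refine (mul_le_mul (hb' x hx) (hb x hx) (norm_nonneg _) (by positivity)).trans_eq ?_
  rw [show (B + B') * ‖x‖ - ‖x‖ ^ 2 = B' * ‖x‖ + (B * ‖x‖ - ‖x‖ ^ 2) by ring, Real.exp_add]
  ring

/-- Translation preserves Gaussian domination: ‖a + x‖² ≥ (‖x‖ - ‖a‖)², whose cross term 2‖a‖‖x‖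
goes into the linear rate. -/
theorem exp_mul_norm_sub_sq_add_le {B : ℝ} (hB : 0 ≤ B) (a x : ℂ) :
    Real.exp (B * ‖a + x‖ - ‖a + x‖ ^ 2) ≤
      Real.exp (B * ‖a‖) * Real.exp ((B + 2 * ‖a‖) * ‖x‖ - ‖x‖ ^ 2) := by
  rw [← Real.exp_add, Real.exp_le_exp]
  have h1 := norm_add_le a x
  have h2 : ‖x‖ - ‖a‖ ≤ ‖a + x‖ := by
    have := norm_sub_le (a + x) a
    rw [add_sub_cancel_left] at this; linarith
  have h3 : ‖a‖ - ‖x‖ ≤ ‖a + x‖ := by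
    have := norm_sub_le (a + x) x
    rw [add_sub_cancel_right] at this; linarith
  have h4 : (‖x‖ - ‖a‖) ^ 2 ≤ ‖a + x‖ ^ 2 :=
    sq_le_sq' (by linarith) h2
  nlinarith [mul_le_mul_of_nonneg_left h1 hB, sq_nonneg ‖a‖]

theorem GaussDomOn.comp_add {φ : ℂ → ℂ} {S T : Set ℂ} (h : GaussDomOn φ S) (a : ℂ)
    (hT : ∀ x ∈ T, a + x ∈ S) : GaussDomOn (fun x => φ (a + x)) T := by
  obtain ⟨C, B, hC, hB, hb⟩ := h
  refine ⟨C * Real.exp (B * ‖a‖), B + 2 * ‖a‖, by positivity, by positivity, fun x hx => ?_⟩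
  rw [mul_assoc]
  exact (hb _ (hT x hx)).trans (mul_le_mul_of_nonneg_left (exp_mul_norm_sub_sq_add_le hB a x) hC)

theorem GaussDomOn.line {φ : ℂ → ℂ} {S : Set ℂ} (h : GaussDomOn φ S) (a : ℂ) {d : ℂ}
    (hd : ‖d‖ = 1) (hS : ∀ u : ℝ, a + u * d ∈ S) : GaussDom (fun u => φ (a + u * d)) := by
  obtain ⟨C, B, hC, hB, hb⟩ := h
  refine ⟨C * Real.exp (B * ‖a‖), B + 2 * ‖a‖, fun u => ?_⟩
  have h1 := exp_mul_norm_sub_sq_add_le hB a (u * d)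
  have h2 : ‖(u * d : ℂ)‖ = |u| := by rw [norm_mul, hd, mul_one, norm_real, Real.norm_eq_abs]
  rw [h2, sq_abs] at h1
  rw [mul_assoc]
  exact (hb _ (hS u)).trans (mul_le_mul_of_nonneg_left h1 hC)

theorem norm_exp_neg_pi_I_sq (α : ℝ) (x : ℂ) : ‖exp (-(Real.pi * I * α * x ^ 2))‖ =
    Real.exp (Real.pi * α * ((x.re + x.im) ^ 2 - ‖x‖ ^ 2)) := by
  rw [Complex.norm_exp, ← Complex.normSq_eq_norm_sq, Complex.normSq_apply]
  congr 1
  simp only [neg_re, mul_re, mul_im, ofReal_re, ofReal_im, I_re, I_im, pow_two]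
  ring

/-- The sum Re x + Im x is constant on lines of direction `dirSE`, so these sets are strips parallel
to the paths; there |e^{-πiαx²}| is at most a constant times e^{-πα‖x‖²}, and πα ≥ 1. -/
theorem gaussDomOn_quadratic {α : ℝ} (hα : 1 ≤ α) (p : ℂ) (c : ℝ) :
    GaussDomOn (fun x => exp (2 * Real.pi * I * p * x) * exp (-(Real.pi * I * α * x ^ 2)))
      {x | |x.re + x.im| ≤ c} := by
  have hg : GaussDomOn (fun x => exp (-(Real.pi * I * α * x ^ 2))) {x | |x.re + x.im| ≤ c} := by
    refine ⟨Real.exp (Real.pi * α * c ^ 2), 0, by positivity, le_rfl, fun x hx => ?_⟩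
    rw [norm_exp_neg_pi_I_sq, ← Real.exp_add, Real.exp_le_exp]
    have h1 : (x.re + x.im) ^ 2 ≤ c ^ 2 := by
      rw [← sq_abs]; exact pow_le_pow_left₀ (abs_nonneg _) hx 2
    have h2 : 1 ≤ Real.pi * α := by nlinarith [Real.pi_gt_three]
    nlinarith [sq_nonneg ‖x‖]
  refine hg.mul (C' := 1) (B' := 2 * Real.pi * ‖p‖) zero_le_one (by positivity) fun x _ => ?_
  rw [one_mul]
  refine (Complex.norm_exp_le_exp_norm _).trans (Real.exp_le_exp.2 (le_of_eq ?_))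
  simp [abs_of_pos Real.pi_pos]

/-! ### Line integrals in the direction `dirSE` -/

theorem add_mul_dirSE_re_add_im (a u : ℝ) : (a + u * dirSE : ℂ).re + (a + u * dirSE : ℂ).im = a := by
  rw [add_re, add_im, re_ofReal_mul, im_ofReal_mul, dirSE_re, dirSE_im]; simp

theorem add_mul_dirSW_re_sub_im (a u : ℝ) : (a + u * dirSW : ℂ).re - (a + u * dirSW : ℂ).im = a := by
  rw [add_re, add_im, re_ofReal_mul, im_ofReal_mul, dirSW_re, dirSW_im]; simp

/-- Rotation by `dirSE` turns diagonal lines into horizontal ones, to which the contour shift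
applies; the line through the real point a comes to lie at height a√2/2. -/
theorem add_mul_dirSE_eq (a u : ℝ) : (a + u * dirSE : ℂ) =
    dirSE * (((u + a * (Real.sqrt 2 / 2) : ℝ) : ℂ) + ((a * (Real.sqrt 2 / 2) : ℝ) : ℂ) * I) := by
  have h : dirSE * (Real.sqrt 2 / 2 : ℝ) * (1 + I) = 1 := by
    rw [dirSE_eq]
    linear_combination (1 - I ^ 2) * sqrt_two_div_two_sq' - (1 / 2) * I_sq
  push_cast at h ⊢
  linear_combination (-a : ℂ) * h

theorem lineIntegral_dirSE (f : ℂ → ℂ) (a : ℝ) : lineIntegral f a dirSE =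
    horizontalIntegral (fun z => f (dirSE * z) * dirSE) (a * (Real.sqrt 2 / 2)) := by
  rw [lineIntegral, horizontalIntegral]
  refine Eq.trans ?_ (integral_add_right_eq_self (μ := volume) (fun u : ℝ =>
    f (dirSE * (u + ((a * (Real.sqrt 2 / 2) : ℝ) : ℂ) * I)) * dirSE) (a * (Real.sqrt 2 / 2)))
  refine integral_congr_ae (Eventually.of_forall fun u => ?_)
  simp only [lineIntegrand]
  rw [add_mul_dirSE_eq]

theorem add_mul_dirSE_ne_zero {a : ℝ} (ha : a ≠ 0) (u : ℝ) : (a + u * dirSE : ℂ) ≠ 0 := by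
  intro h
  have := add_mul_dirSE_re_add_im a u
  rw [h] at this
  simp at this
  exact ha this.symm

theorem integrable_horizontal_of_lineIntegrand {f : ℂ → ℂ} {a : ℝ}
    (h : Integrable (lineIntegrand f a dirSE)) : Integrable fun u : ℝ =>
      f (dirSE * (u + ((a * (Real.sqrt 2 / 2) : ℝ) : ℂ) * I)) * dirSE := by
  refine (h.comp_add_right (-(a * (Real.sqrt 2 / 2)))).congr (Eventually.of_forall fun u => ?_)
  simp only [lineIntegrand]
  rw [add_mul_dirSE_eq, show u + -(a * (Real.sqrt 2 / 2)) + a * (Real.sqrt 2 / 2) = u by ring]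

theorem integrable_lineIntegrand_of_gaussDom {d : ℂ} (hd : d = dirSE ∨ d = dirSW) {φ : ℂ → ℂ}
    (n : ℤ) (hφ : GaussDom fun u => φ (n + 1 / 2 + u * d))
    (hc : Continuous fun u : ℝ => φ (n + 1 / 2 + u * d)) :
    Integrable (lineIntegrand (fun x => φ x / expDiff x) (n + 1 / 2) d) := by
  have h2 := two_le_norm_expDiff_line hd n
  have hd1 : ‖d‖ = 1 := by rcases hd with rfl | rfl; exacts [norm_dirSE, norm_dirSW]
  have hD : Continuous fun u : ℝ => expDiff (n + 1 / 2 + u * d) := by fun_prop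
  have hne : ∀ u : ℝ, expDiff (n + 1 / 2 + u * d) ≠ 0 := fun u h => by
    have := h2 u; rw [h, norm_zero] at this; linarith
  refine (hφ.integrable hc.aestronglyMeasurable).mono
    ((hc.div hD hne).mul continuous_const).aestronglyMeasurable (Eventually.of_forall fun u => ?_)
  rw [lineIntegrand, norm_mul, hd1, mul_one, norm_div]
  exact div_le_self (norm_nonneg _) (by linarith [h2 u])

/-- The zero at the origin is simple, with derivative 2πi, so dividing it out leaves a nonvanishing
function. -/
theorem dslope_expDiff_ne_zero {x : ℂ} (hx : x ≠ 0 → expDiff x ≠ 0) : dslope expDiff 0 x ≠ 0 := by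
  rcases eq_or_ne x 0 with rfl | hx0
  · have : HasDerivAt expDiff (2 * (Real.pi * I)) 0 := by
      have h1 : HasDerivAt (fun x : ℂ => Real.pi * I * x) (Real.pi * I * 1) 0 :=
        (hasDerivAt_id _).const_mul _
      exact (h1.cexp.sub h1.neg.cexp).congr_deriv (by simp; ring)
    rw [dslope_same, this.deriv]
    simp [Real.pi_ne_zero]
  · rw [dslope_of_ne _ hx0, slope_def_field, show expDiff 0 = 0 by simp [expDiff], sub_zero, sub_zero]
    exact div_ne_zero (hx hx0) hx0

/-- Moving a line integral across the zero of the denominator at `0`, when the numerator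
vanishes there. -/
theorem lineIntegral_eq_of_apply_zero {φ : ℂ → ℂ}
    (hd : DifferentiableOn ℂ φ {x | |x.re + x.im| < 1})
    (hg : GaussDomOn φ {x | |x.re + x.im| ≤ 1 / 2}) (h0 : φ 0 = 0) :
    lineIntegral (fun x => φ x / expDiff x) (-1 / 2) dirSE =
      lineIntegral (fun x => φ x / expDiff x) (1 / 2) dirSE := by
  set S : Set ℂ := {x | |x.re + x.im| < 1} with hS
  have hSo : IsOpen S := isOpen_lt (by fun_prop) continuous_const
  have hS0 : S ∈ 𝓝 (0 : ℂ) := hSo.mem_nhds (by simp [hS])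
  -- Dividing the numerator and the denominator by x gives the holomorphic extension of the quotient
  -- over 0, the only integer in the strip.
  set Q : ℂ → ℂ := fun x => dslope φ 0 x / dslope expDiff 0 x with hQ
  have hE0 : expDiff 0 = 0 := by simp [expDiff]
  have hE1 : ∀ x ∈ S, x ≠ 0 → expDiff x ≠ 0 := by
    intro x hx hx0 h
    obtain ⟨n, rfl⟩ := expDiff_eq_zero_iff.1 h
    have h1 : |(n : ℝ)| < 1 := by simpa [hS] using hx
    have h2 : n = 0 := by
      have : |n| < 1 := by exact_mod_cast h1
      exact Int.abs_lt_one_iff.1 this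
    exact hx0 (by simp [h2])
  have hQe : ∀ x, x ≠ 0 → Q x = φ x / expDiff x := by
    intro x hx
    simp only [hQ]
    rw [dslope_of_ne _ hx, dslope_of_ne _ hx, slope_def_field, slope_def_field, h0, hE0, sub_zero,
      sub_zero, sub_zero, div_div_div_cancel_right₀ hx]
  have hQd : DifferentiableOn ℂ Q S := by
    refine ((differentiableOn_dslope hS0).2 hd).div
      ((differentiableOn_dslope hS0).2 differentiable_expDiff.differentiableOn) fun x hx => ?_
    exact dslope_expDiff_ne_zero (hE1 x hx)
  have hline : ∀ a : ℝ, a ≠ 0 → lineIntegral (fun x => φ x / expDiff x) a dirSE =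
      lineIntegral Q a dirSE := by
    intro a ha
    refine integral_congr_ae (Eventually.of_forall fun u => ?_)
    show φ _ / expDiff _ * dirSE = Q _ * dirSE
    rw [hQe]
    intro h
    have := add_mul_dirSE_re_add_im a u
    rw [h] at this
    simp at this
    exact ha this.symm
  have hQi : ∀ (n : ℤ) (a : ℝ), |a| ≤ 1 / 2 → a ≠ 0 → a = n + 1 / 2 →
      Integrable (lineIntegrand Q a dirSE) := by
    intro n a ha ha0 hn
    have hm : ∀ u : ℝ, (a + u * dirSE : ℂ) ∈ {x : ℂ | |x.re + x.im| ≤ 1 / 2} := fun u => by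
      simpa only [Set.mem_ofPred_eq, add_mul_dirSE_re_add_im] using ha
    have hc : Continuous fun u : ℝ => φ (a + u * dirSE) :=
      hd.continuousOn.comp_continuous (by fun_prop) fun u =>
        by
        have : |_| ≤ (1 / 2 : ℝ) := hm u
        exact this.trans_lt (by norm_num)
    have hl := hg.line a norm_dirSE hm
    have e : (a : ℂ) = n + 1 / 2 := by rw [hn]; push_cast; ring
    rw [e] at hl hc
    have := integrable_lineIntegrand_of_gaussDom (Or.inl rfl) n hl hc
    rw [← e] at this
    refine this.congr (Eventually.of_forall fun u => ?_)
    simp only [lineIntegrand]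
    rw [hQe _ (add_mul_dirSE_ne_zero ha0 u)]
  have e1 : (-1 / 2 : ℂ) = ((-1 / 2 : ℝ) : ℂ) := by push_cast; ring
  have e2 : (1 / 2 : ℂ) = ((1 / 2 : ℝ) : ℂ) := by push_cast; ring
  rw [e1, e2, hline _ (by norm_num), hline _ (by norm_num), lineIntegral_dirSE, lineIntegral_dirSE]
  have hmem : ∀ z : ℂ, (dirSE * z).re + (dirSE * z).im = Real.sqrt 2 * z.im := by
    intro z; rw [mul_re, mul_im, dirSE_re, dirSE_im]; ring
  obtain ⟨C, B, hC, hB, hb⟩ := hg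
  have hr : 0 < Real.sqrt 2 := by positivity
  have hr2 := sqrt_two_div_two_sq
  have hr1 : Real.sqrt 2 * Real.sqrt 2 = 2 := Real.mul_self_sqrt (by norm_num)
  have hmap : ∀ z : ℂ, -1 / 2 * (Real.sqrt 2 / 2) ≤ z.im → z.im ≤ 1 / 2 * (Real.sqrt 2 / 2) →
      |(dirSE * z).re + (dirSE * z).im| ≤ 1 / 2 := by
    intro z h1 h2
    rw [hmem, abs_le]
    constructor <;> nlinarith
  have hF : DifferentiableOn ℂ (fun z => Q (dirSE * z) * dirSE)
      {z | -1 / 2 * (Real.sqrt 2 / 2) ≤ z.im ∧ z.im ≤ 1 / 2 * (Real.sqrt 2 / 2)} := by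
    refine (hQd.comp (by fun_prop) fun z hz => ?_).mul_const _
    exact (hmap z hz.1 hz.2).trans_lt (by norm_num)
  -- In the strip |Im z| ≤ 1, so |Re z| ≥ 3 makes the rotated point have |Im| ≥ √2 ≥ 1, where the
  -- denominator is at least 1 in modulus. The factor e^B pays for ‖z‖ ≤ |Re z| + 1.
  refine horizontalIntegral_eq_of_differentiableOn (C := C * Real.exp B) (B := B) (T₀ := 3)
    (by nlinarith) hF.continuousOn (hF.mono fun z hz => ⟨hz.1.le, hz.2.le⟩) ?_
    (integrable_horizontal_of_lineIntegrand (hQi (-1) _ (by norm_num [abs_div]) (by norm_num) (by norm_num)))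
    (integrable_horizontal_of_lineIntegrand (hQi 0 _ (by norm_num [abs_div]) (by norm_num) (by norm_num)))
  intro z h1 h2 h3
  have hz0 : dirSE * z ≠ 0 := by
    refine mul_ne_zero dirSE_ne_zero ?_
    rintro rfl
    simp at h3; linarith
  have hn : ‖dirSE * z‖ = ‖z‖ := by rw [norm_mul, norm_dirSE, one_mul]
  have hle : Real.sqrt 2 ≤ 2 := by nlinarith
  have hge : 1 ≤ Real.sqrt 2 := by nlinarith
  have him : |z.im| ≤ 1 := abs_le.2 ⟨by nlinarith, by nlinarith⟩
  have hexp : 1 ≤ ‖expDiff (dirSE * z)‖ := by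
    apply one_le_norm_expDiff
    rw [mul_im, dirSE_re, dirSE_im, show Real.sqrt 2 / 2 * z.im + -(Real.sqrt 2 / 2) * z.re =
      Real.sqrt 2 / 2 * (z.im - z.re) by ring, abs_mul, abs_of_pos (by positivity)]
    have := abs_sub_abs_le_abs_sub z.re z.im
    rw [abs_sub_comm] at this
    nlinarith
  rw [hQe _ hz0, norm_mul, norm_dirSE, mul_one, norm_div]
  have h5 := hb (dirSE * z) (hmap z h1 h2)
  rw [hn] at h5
  refine (div_le_self (norm_nonneg _) hexp).trans (h5.trans ?_)
  rw [mul_assoc, ← Real.exp_add]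
  refine mul_le_mul_of_nonneg_left (Real.exp_le_exp.2 ?_) hC
  have h6 := Complex.norm_le_abs_re_add_abs_im z
  have h7 : z.re ^ 2 ≤ ‖z‖ ^ 2 := by
    rw [← Complex.normSq_eq_norm_sq, Complex.normSq_apply]; nlinarith [sq_nonneg z.im]
  nlinarith [mul_le_mul_of_nonneg_left (h6.trans (add_le_add_right him _)) hB]

/-! ### Gaussian integrals with the denominator `e^{π i x} - e^{-π i x}` -/

/-- `e^{2π i p x - π i α x²}`. -/
def quadExp (α : ℝ) (p x : ℂ) : ℂ :=
  exp (2 * Real.pi * I * p * x) * exp (-(Real.pi * I * α * x ^ 2))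

theorem differentiable_quadExp (α : ℝ) (p : ℂ) : Differentiable ℂ (quadExp α p) := by
  unfold quadExp; fun_prop

theorem gaussDomOn_quadExp {α : ℝ} (hα : 1 ≤ α) (p : ℂ) (c : ℝ) :
    GaussDomOn (quadExp α p) {x | |x.re + x.im| ≤ c} := gaussDomOn_quadratic hα p c

theorem gaussDom_line_of_strip {φ : ℂ → ℂ} {a c : ℝ} (h : GaussDomOn φ {x | |x.re + x.im| ≤ c})
    (ha : |a| ≤ c) : GaussDom fun u => φ (a + u * dirSE) :=
  h.line a norm_dirSE fun u => by simpa only [Set.mem_ofPred_eq, add_mul_dirSE_re_add_im] using ha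

theorem integrable_quadExp_div {α : ℝ} (hα : 1 ≤ α) (p : ℂ) (n : ℤ) :
    Integrable (lineIntegrand (fun x => quadExp α p x / expDiff x) (n + 1 / 2) dirSE) := by
  have h := gaussDom_line_of_strip (a := n + 1 / 2) (gaussDomOn_quadExp hα p _) le_rfl
  refine integrable_lineIntegrand_of_gaussDom (Or.inl rfl) n (by simpa using h) ?_
  exact (differentiable_quadExp α p).continuous.comp (by fun_prop)

/-- Completing the square removes the base point a, since the integrand is entire. -/
theorem lineIntegral_quadExp {α : ℝ} (hα : 1 ≤ α) (p : ℂ) (a : ℂ) :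
    lineIntegral (quadExp α p) a dirSE =
      dirSE * (1 / α : ℂ) ^ (1 / 2 : ℂ) * exp (Real.pi * I * p ^ 2 / α) := by
  have hα0 : (α : ℂ) ≠ 0 := by exact_mod_cast (by linarith : α ≠ 0)
  have hπ : (Real.pi : ℂ) ≠ 0 := by exact_mod_cast Real.pi_ne_zero
  have hb : (-(Real.pi * α : ℂ)).re < 0 := by
    rw [neg_re, ← ofReal_mul, ofReal_re]
    have := mul_pos Real.pi_pos (by linarith : 0 < α)
    linarith
  have h := integral_cexp_quadratic hb (2 * Real.pi * I * (p - α * a) * dirSE)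
    (2 * Real.pi * I * p * a - Real.pi * I * α * a ^ 2)
  rw [neg_neg, div_mul_cancel_left₀ hπ, ← one_div] at h
  have e : ∀ u : ℝ, lineIntegrand (quadExp α p) a dirSE u = exp (-(Real.pi * α) * u ^ 2 +
      2 * Real.pi * I * (p - α * a) * dirSE * u +
        (2 * Real.pi * I * p * a - Real.pi * I * α * a ^ 2)) * dirSE := by
    intro u
    rw [lineIntegrand, quadExp, ← Complex.exp_add]
    congr 2
    linear_combination (-(Real.pi * I * α * u ^ 2)) * dirSE_sq + Real.pi * α * u ^ 2 * I_sq
  have e2 : 2 * Real.pi * I * p * a - Real.pi * I * α * a ^ 2 -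
      (2 * Real.pi * I * (p - α * a) * dirSE) ^ 2 / (4 * -(Real.pi * α)) =
      Real.pi * I * p ^ 2 / α := by
    rw [mul_pow, dirSE_sq]
    field_simp
    linear_combination (-4 * (p - α * a) ^ 2) * I_sq
  rw [lineIntegral, integral_congr_ae (Eventually.of_forall e), integral_mul_const, h, e2]
  ring

/-- The integral of `e^{2π i p x - π i α x²} / (e^{π i x} - e^{-π i x})` along `0 ↘ 1`. -/
def gaussSine (α : ℝ) (p : ℂ) : ℂ :=
  lineIntegral (fun x => quadExp α p x / expDiff x) (1 / 2) dirSE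

theorem quadExp_add_half_sub (α : ℝ) (p x : ℂ) :
    quadExp α (p + 1 / 2) x - quadExp α (p - 1 / 2) x = quadExp α p x * expDiff x := by
  rw [quadExp, quadExp, quadExp, expDiff, ← sub_mul,
    show 2 * Real.pi * I * (p + 1 / 2) * x = 2 * Real.pi * I * p * x + Real.pi * I * x by ring,
    show 2 * Real.pi * I * (p - 1 / 2) * x = 2 * Real.pi * I * p * x + -(Real.pi * I * x) by ring,
    Complex.exp_add, Complex.exp_add]
  ring

theorem expDiff_line_ne_zero {d : ℂ} (hd : d = dirSE ∨ d = dirSW) (n : ℤ) (u : ℝ) :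
    expDiff (n + 1 / 2 + u * d) ≠ 0 := fun h => by
  have := two_le_norm_expDiff_line hd n u
  rw [h, norm_zero] at this; linarith

/-- First difference equation: the shifts p ± 1/2 reproduce the denominator, which cancels and
leaves a pure Gaussian integral. -/
theorem gaussSine_add_half_sub {α : ℝ} (hα : 1 ≤ α) (p : ℂ) :
    gaussSine α (p + 1 / 2) - gaussSine α (p - 1 / 2) =
      dirSE * (1 / α : ℂ) ^ (1 / 2 : ℂ) * exp (Real.pi * I * p ^ 2 / α) := by
  have h1 := integrable_quadExp_div hα (p + 1 / 2) 0
  have h2 := integrable_quadExp_div hα (p - 1 / 2) 0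
  rw [Int.cast_zero, zero_add] at h1 h2
  rw [gaussSine, gaussSine, lineIntegral, lineIntegral, ← integral_sub h1 h2,
    ← lineIntegral_quadExp hα p (1 / 2)]
  refine integral_congr_ae (Eventually.of_forall fun u => ?_)
  have h3 := expDiff_line_ne_zero (Or.inl rfl : dirSE = dirSE ∨ _) 0 u
  rw [Int.cast_zero, zero_add] at h3
  simp only [lineIntegrand]
  rw [← sub_mul, ← sub_div, quadExp_add_half_sub, mul_div_cancel_right₀ _ h3]

theorem lineIntegral_add (f : ℂ → ℂ) (a b d : ℂ) :
    lineIntegral f (a + b) d = lineIntegral (fun x => f (b + x)) a d := by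
  refine integral_congr_ae (Eventually.of_forall fun u => ?_)
  simp only [lineIntegrand]
  congr 2; ring

theorem lineIntegral_congr {f g : ℂ → ℂ} {a d : ℂ} (h : ∀ u : ℝ, f (a + u * d) = g (a + u * d)) :
    lineIntegral f a d = lineIntegral g a d :=
  integral_congr_ae (Eventually.of_forall fun u => by simp only [lineIntegrand, h])

theorem lineIntegral_const_mul (c : ℂ) (f : ℂ → ℂ) (a d : ℂ) :
    lineIntegral (fun x => c * f x) a d = c * lineIntegral f a d := by
  rw [lineIntegral, lineIntegral, ← integral_const_mul]
  refine integral_congr_ae (Eventually.of_forall fun u => ?_)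
  simp only [lineIntegrand, mul_assoc]

theorem lineIntegral_neg_point (f : ℂ → ℂ) (a d : ℂ) :
    lineIntegral f (-a) d = lineIntegral (fun x => f (-x)) a d := by
  rw [lineIntegral, ← integral_neg_eq_self]
  refine integral_congr_ae (Eventually.of_forall fun u => ?_)
  simp only [lineIntegrand]
  congr 2; push_cast; ring

/-- Under x ↦ -x the direction is kept once u is also reversed, p changes sign, and the odd
denominator contributes the minus sign. -/
theorem gaussSine_neg_half (α : ℝ) (p : ℂ) :
    lineIntegral (fun x => quadExp α p x / expDiff x) (-1 / 2) dirSE = -gaussSine α (-p) := by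
  rw [neg_div, lineIntegral_neg_point, gaussSine, ← neg_one_mul, ← lineIntegral_const_mul]
  refine lineIntegral_congr fun u => ?_
  rw [expDiff_neg, quadExp, quadExp]
  simp only [mul_neg, neg_mul, neg_sq, div_neg, one_mul]

/-- The difference equation gives g(1) - g(0) = 1. Translating by 1 and then reflecting gives g(1) =
-g(0), because numerator and denominator both change sign under the translation. No pole is crossed.
-/
theorem gaussSine_one_zero : gaussSine 1 0 = -1 / 2 := by
  have h1 := gaussSine_add_half_sub le_rfl (1 / 2)
  have e1 : gaussSine 1 (1 / 2 + 1 / 2) - gaussSine 1 (1 / 2 - 1 / 2) = 1 := by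
    rw [h1, dirSE, ofReal_one, div_one, one_cpow, mul_one, ← Complex.exp_add]
    convert Complex.exp_zero using 2; ring
  norm_num at e1
  have h2 : gaussSine 1 1 = lineIntegral (fun x => quadExp 1 0 x / expDiff x) (-1 / 2) dirSE := by
    rw [gaussSine, show (1 / 2 : ℂ) = -1 / 2 + 1 by ring, lineIntegral_add]
    refine lineIntegral_congr fun u => ?_
    generalize (-1 / 2 + u * dirSE : ℂ) = x
    have h3 := expDiff_add_intCast x 1
    rw [Int.cast_one, zpow_one] at h3
    have h4 : quadExp 1 1 (1 + x) = - quadExp 1 0 x := by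
      rw [quadExp, quadExp, ← Complex.exp_add, ← Complex.exp_add,
        show 2 * Real.pi * I * 1 * (1 + x) + -(Real.pi * I * (1 : ℝ) * (1 + x) ^ 2) =
          2 * Real.pi * I * 0 * x + -(Real.pi * I * (1 : ℝ) * x ^ 2) + Real.pi * I by
            push_cast; ring,
        Complex.exp_add _ (Real.pi * I : ℂ), exp_pi_mul_I, mul_neg_one]
    rw [add_comm 1 x, h3, ← add_comm 1 x, h4, neg_one_mul, neg_div_neg_eq]
  rw [gaussSine_neg_half, neg_zero] at h2
  linear_combination (-1 / 2) * e1 + (1 / 2) * h2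

/-- Moving a line integral across the pole at `0`. -/
theorem lineIntegral_sub_eq_apply_zero {φ : ℂ → ℂ}
    (hd : DifferentiableOn ℂ φ {x | |x.re + x.im| < 1})
    (hg : GaussDomOn φ {x | |x.re + x.im| ≤ 1 / 2}) :
    lineIntegral (fun x => φ x / expDiff x) (-1 / 2) dirSE -
      lineIntegral (fun x => φ x / expDiff x) (1 / 2) dirSE = φ 0 := by
  -- As `quadExp 1 0` equals 1 at the origin, the difference vanishes there. Its own jump between
  -- the two paths is -2 `gaussSine 1 0` = 1.
  have hψ := lineIntegral_eq_of_apply_zero (φ := fun x => φ x - φ 0 * quadExp 1 0 x)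
    (hd.sub ((differentiable_quadExp 1 0).const_mul _).differentiableOn)
    (hg.sub ((gaussDomOn_quadExp le_rfl 0 _).const_mul _)) (by simp [quadExp])
  have key : ∀ n : ℤ, |(n + 1 / 2 : ℝ)| ≤ 1 / 2 →
      lineIntegral (fun x => (φ x - φ 0 * quadExp 1 0 x) / expDiff x) (n + 1 / 2) dirSE =
      lineIntegral (fun x => φ x / expDiff x) (n + 1 / 2) dirSE -
        φ 0 * lineIntegral (fun x => quadExp 1 0 x / expDiff x) (n + 1 / 2) dirSE := by
    intro n hn
    have hl := gaussDom_line_of_strip hg hn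
    have hc : Continuous fun u : ℝ => φ ((n + 1 / 2 : ℝ) + u * dirSE) := by
      refine hd.continuousOn.comp_continuous (by fun_prop) fun u => ?_
      simp only [Set.mem_ofPred_eq, add_mul_dirSE_re_add_im]
      exact hn.trans_lt (by norm_num)
    have hi := integrable_lineIntegrand_of_gaussDom (Or.inl rfl) n (φ := φ) (by simpa using hl)
      (by simpa using hc)
    rw [← lineIntegral_const_mul, lineIntegral, lineIntegral, lineIntegral, ← integral_sub hi]
    · refine integral_congr_ae (Eventually.of_forall fun u => ?_)
      simp only [lineIntegrand]; ring
    · refine ((integrable_quadExp_div le_rfl 0 n).const_mul (φ 0)).congr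
        (Eventually.of_forall fun u => ?_)
      simp only [lineIntegrand]; ring
  have k0 := key 0 (by norm_num)
  have k1 := key (-1) (by norm_num [abs_div])
  rw [show (((0 : ℤ) : ℂ) + 1 / 2) = 1 / 2 by norm_num] at k0
  rw [show (((-1 : ℤ) : ℂ) + 1 / 2) = -1 / 2 by norm_num] at k1
  rw [k0, k1, gaussSine_neg_half, neg_zero,
    show lineIntegral (fun x => quadExp 1 0 x / expDiff x) (1 / 2) dirSE = gaussSine 1 0 from rfl,
    gaussSine_one_zero] at hψ
  linear_combination hψ

/-- Moving a line integral across the pole at the integer `n`. -/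
theorem lineIntegral_sub_eq_apply_intCast {φ : ℂ → ℂ} (n : ℤ)
    (hd : DifferentiableOn ℂ φ {x | |x.re + x.im - n| < 1})
    (hg : GaussDomOn φ {x | |x.re + x.im - n| ≤ 1 / 2}) :
    lineIntegral (fun x => φ x / expDiff x) (n - 1 / 2) dirSE -
      lineIntegral (fun x => φ x / expDiff x) (n + 1 / 2) dirSE = (-1) ^ n * φ n := by
  have h := lineIntegral_sub_eq_apply_zero (φ := fun x => φ (n + x))
    (hd.comp (by fun_prop) fun x hx => ?_) (hg.comp_add n fun x hx => ?_)
  · have hs : ((-1 : ℂ) ^ n) * (-1) ^ n = 1 := by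
      rw [← mul_zpow]; simp
    have hs' : ((-1 : ℂ) ^ n) ≠ 0 := zpow_ne_zero _ (by norm_num)
    have key : ∀ a : ℂ, lineIntegral (fun x => φ x / expDiff x) (a + n) dirSE =
        (-1) ^ n * lineIntegral (fun x => φ (n + x) / expDiff x) a dirSE := by
      intro a
      rw [lineIntegral_add, ← lineIntegral_const_mul]
      refine lineIntegral_congr fun u => ?_
      generalize (a + u * dirSE : ℂ) = x
      rw [show expDiff (n + x) = (-1) ^ n * expDiff x by rw [add_comm, expDiff_add_intCast]]
      rw [← mul_div_mul_left _ _ hs', ← mul_assoc ((-1) ^ n) ((-1) ^ n) (expDiff x), hs, one_mul,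
        mul_div_assoc]
    rw [show (n - 1 / 2 : ℂ) = -1 / 2 + n by ring, show (n + 1 / 2 : ℂ) = 1 / 2 + n by ring, key,
      key, ← mul_sub, h, add_zero]
  · have : |x.re + x.im| < 1 := hx
    simpa [add_assoc, add_sub_assoc, add_comm, add_left_comm] using this
  · have : |x.re + x.im| ≤ 1 / 2 := hx
    simpa [add_assoc, add_sub_assoc, add_comm, add_left_comm] using this

theorem GaussDomOn.quadExp_strip {α : ℝ} (hα : 1 ≤ α) (p : ℂ) (n : ℤ) :
    GaussDomOn (quadExp α p) {x | |x.re + x.im - n| ≤ 1 / 2} :=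
  (gaussDomOn_quadExp hα p (|(n : ℝ)| + 1 / 2)).mono fun x hx => by
    have h1 : |x.re + x.im - n| ≤ 1 / 2 := hx
    have h2 := abs_sub_abs_le_abs_sub (x.re + x.im) n
    show |x.re + x.im| ≤ _
    linarith

/-- Second difference equation: moving the path across the pole at 1 and translating it back by 1
replaces p by p - α. -/
theorem gaussSine_add_mul {α : ℝ} (hα : 1 ≤ α) (p : ℂ) :
    gaussSine α p + exp (2 * Real.pi * I * p - Real.pi * I * α) * gaussSine α (p - α) =
      -exp (2 * Real.pi * I * p - Real.pi * I * α) := by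
  have h := lineIntegral_sub_eq_apply_intCast 1 (differentiable_quadExp α p).differentiableOn
    (GaussDomOn.quadExp_strip hα p 1)
  have h2 : lineIntegral (fun x => quadExp α p x / expDiff x) (1 / 2 + 1) dirSE =
      -(exp (2 * Real.pi * I * p - Real.pi * I * α) * gaussSine α (p - α)) := by
    rw [gaussSine, lineIntegral_add, ← neg_mul, ← lineIntegral_const_mul]
    refine lineIntegral_congr fun u => ?_
    generalize (1 / 2 + u * dirSE : ℂ) = x
    have h3 := expDiff_add_intCast x 1
    rw [Int.cast_one, zpow_one, add_comm x] at h3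
    have h4 : quadExp α p (1 + x) =
        exp (2 * Real.pi * I * p - Real.pi * I * α) * quadExp α (p - α) x := by
      rw [quadExp, quadExp, ← Complex.exp_add, ← Complex.exp_add, ← Complex.exp_add]
      congr 1; ring
    rw [h3, h4, neg_one_mul, div_neg, neg_mul, mul_div_assoc]
  rw [Int.cast_one, zpow_one, show (1 - 1 / 2 : ℂ) = 1 / 2 by norm_num, add_comm (1 : ℂ), h2,
    show quadExp α p 1 = exp (2 * Real.pi * I * p - Real.pi * I * α) by
      rw [quadExp, ← Complex.exp_add]; congr 1; ring] at h
  simp only [gaussSine] at h ⊢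
  linear_combination h

theorem expDiff_half_line_ne_zero {d : ℂ} (hd : d = dirSE ∨ d = dirSW) (u : ℝ) :
    expDiff (1 / 2 + u * d) ≠ 0 := by
  simpa using expDiff_line_ne_zero hd 0 u

theorem one_le_norm_expDiff_half_line {d : ℂ} (hd : d = dirSE ∨ d = dirSW) (u : ℝ) :
    1 ≤ ‖expDiff (1 / 2 + u * d)‖ := by
  have := two_le_norm_expDiff_line hd 0 u
  rw [Int.cast_zero, zero_add] at this
  linarith

theorem exp_two_pi_I_mul_sub_one (p : ℂ) :
    exp (-(2 * Real.pi * I * p)) - 1 = -(exp (-(Real.pi * I * p)) * expDiff p) := by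
  rw [expDiff, mul_sub, ← Complex.exp_add, ← Complex.exp_add, neg_add_cancel, Complex.exp_zero,
    show -(2 * Real.pi * I * p) = -(Real.pi * I * p) + -(Real.pi * I * p) by ring]
  ring

/-- Riemann's evaluation of the Gaussian integral with `α = 1`. -/
theorem gaussSine_one_eq {p : ℂ} (hp : expDiff p ≠ 0) :
    exp (Real.pi * I * p ^ 2) / expDiff p =
      gaussSine 1 p - 1 / (exp (-(2 * Real.pi * I * p)) - 1) := by
  have h1 := gaussSine_add_half_sub le_rfl (p - 1 / 2)
  have h2 := gaussSine_add_mul le_rfl p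
  have e1 : dirSE * (1 / (1 : ℝ) : ℂ) ^ (1 / 2 : ℂ) *
      exp (Real.pi * I * (p - 1 / 2) ^ 2 / (1 : ℝ)) =
      exp (Real.pi * I * p ^ 2) * exp (-(Real.pi * I * p)) := by
    rw [dirSE, ofReal_one, div_one, div_one, one_cpow, mul_one, ← Complex.exp_add,
      ← Complex.exp_add]
    congr 1; ring
  rw [e1, sub_add_cancel, show p - 1 / 2 - 1 / 2 = p - 1 by ring] at h1
  have e2 : exp (2 * Real.pi * I * p - Real.pi * I * (1 : ℝ)) =
      -(exp (Real.pi * I * p) * exp (Real.pi * I * p)) := by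
    rw [ofReal_one, mul_one, Complex.exp_sub, exp_pi_mul_I, div_neg, div_one, ← Complex.exp_add]
    congr 2; ring
  rw [e2, ofReal_one] at h2
  have e3 : exp (Real.pi * I * p) * exp (-(Real.pi * I * p)) = 1 := by
    rw [← Complex.exp_add, add_neg_cancel, Complex.exp_zero]
  rw [exp_two_pi_I_mul_sub_one]
  set E := exp (Real.pi * I * p) with hE
  set E' := exp (-(Real.pi * I * p)) with hE'
  have hE'0 : E' ≠ 0 := exp_ne_zero _
  have hD : expDiff p = E - E' := rfl
  have e4 : 1 / (-(E' * expDiff p)) = -(E / expDiff p) := by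
    rw [div_neg, neg_inj, div_eq_div_iff (mul_ne_zero hE'0 hp) hp]
    linear_combination (-expDiff p) * e3
  -- For α = 1 both difference equations involve only p and p - 1; eliminating the value at p - 1
  -- solves them.
  rw [e4, sub_neg_eq_add, div_eq_iff hp, add_mul, div_mul_cancel₀ _ hp, hD]
  linear_combination (-E) * h1 + E' * h2 +
    (-exp (Real.pi * I * p ^ 2) + E * gaussSine 1 (p - 1) + E) * e3

/-- Evaluation of the Gaussian integral with `α = 2`. -/
theorem two_cos_mul_gaussSine_two (p : ℂ) :
    2 * cos (2 * Real.pi * p) * (exp (-(2 * Real.pi * I * p ^ 2)) * gaussSine 2 (2 * p)) =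
      (Real.sqrt 2 : ℂ) * exp (3 * Real.pi * I / 8) * sin (Real.pi * p) -
        exp (2 * Real.pi * I * p - 2 * Real.pi * I * p ^ 2) := by
  -- For α = 2 the second equation shifts by 2, so two unit steps of the first are added. The
  -- eliminant 1 + e^{4πip} becomes the factor 2 cos 2πp.
  have h1 := gaussSine_add_half_sub one_le_two (2 * p - 1 / 2)
  have h2 := gaussSine_add_half_sub one_le_two (2 * p - 3 / 2)
  have h3 := gaussSine_add_mul one_le_two (2 * p)
  have hc : (1 / (2 : ℝ) : ℂ) ^ (1 / 2 : ℂ) = (Real.sqrt 2 : ℂ) / 2 := by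
    rw [show (1 / (2 : ℝ) : ℂ) = ((1 / 2 : ℝ) : ℂ) by push_cast; rfl,
      show (1 / 2 : ℂ) = ((1 / 2 : ℝ) : ℂ) by push_cast; rfl,
      ← ofReal_cpow (by norm_num), ← Real.sqrt_eq_rpow, show (2 : ℂ) = ((2 : ℝ) : ℂ) by norm_cast,
      ← ofReal_div, one_div, Real.sqrt_inv]
    congr 1
    rw [inv_eq_iff_eq_inv, inv_div, eq_div_iff (by positivity)]
    exact Real.mul_self_sqrt (by norm_num)
  rw [hc, show 2 * p - 1 / 2 + 1 / 2 = 2 * p by ring,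
    show 2 * p - 1 / 2 - 1 / 2 = 2 * p - 1 by ring] at h1
  rw [hc, show 2 * p - 3 / 2 + 1 / 2 = 2 * p - 1 by ring,
    show 2 * p - 3 / 2 - 1 / 2 = 2 * p - 2 by ring] at h2
  have e0 : exp (2 * Real.pi * I * (2 * p) - Real.pi * I * (2 : ℝ)) =
      exp (4 * Real.pi * I * p) := by
    rw [show 2 * Real.pi * I * (2 * p) - Real.pi * I * (2 : ℝ) =
      4 * Real.pi * I * p - 2 * Real.pi * I by push_cast; ring, Complex.exp_sub, exp_two_pi_mul_I,
      div_one]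
  rw [e0, ofReal_ofNat] at h3
  set X := exp (2 * Real.pi * I * p - 2 * Real.pi * I * p ^ 2)
  have a1 : 2 * cos (2 * Real.pi * p) * exp (-(2 * Real.pi * I * p ^ 2)) * exp (4 * Real.pi * I * p) =
      X * (1 + exp (4 * Real.pi * I * p)) := by
    simp only [X]
    rw [Complex.two_cos, mul_add, add_mul, add_mul, ← Complex.exp_add, ← Complex.exp_add,
      ← Complex.exp_add, ← Complex.exp_add, mul_one, ← Complex.exp_add]
    rw [add_comm]
    congr 2 <;> ring
  have a2 : X * (dirSE * exp (Real.pi * I * (2 * p - 1 / 2) ^ 2 / (2 : ℝ))) =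
      exp (3 * Real.pi * I / 8) * -I * exp (Real.pi * p * I) := by
    rw [← Complex.exp_neg_pi_div_two_mul_I]
    simp only [X]
    rw [dirSE, ← Complex.exp_add, ← Complex.exp_add, ← Complex.exp_add, ← Complex.exp_add]
    congr 1; push_cast; ring
  have a3 : X * (dirSE * exp (Real.pi * I * (2 * p - 3 / 2) ^ 2 / (2 : ℝ))) =
      exp (3 * Real.pi * I / 8) * I * exp (-(Real.pi * p) * I) := by
    have hI := Complex.exp_pi_div_two_mul_I
    have h : X * (dirSE * exp (Real.pi * I * (2 * p - 3 / 2) ^ 2 / (2 : ℝ))) =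
        exp (3 * Real.pi * I / 8) * exp (Real.pi / 2 * I) * exp (-(Real.pi * p) * I) := by
      simp only [X]
      rw [dirSE, ← Complex.exp_add, ← Complex.exp_add, ← Complex.exp_add, ← Complex.exp_add]
      congr 1; push_cast; ring
    rwa [hI] at h
  have hQ : exp (4 * Real.pi * I * p) ≠ 0 := exp_ne_zero _
  have a4 : 2 * sin (Real.pi * p) = (exp (-(Real.pi * p) * I) - exp (Real.pi * p * I)) * I :=
    Complex.two_sin _
  generalize exp (4 * Real.pi * I * p) = Q at *
  generalize exp (Real.pi * I * (2 * p - 1 / 2) ^ 2 / (2 : ℝ)) = g1 at *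
  generalize exp (Real.pi * I * (2 * p - 3 / 2) ^ 2 / (2 : ℝ)) = g2 at *
  generalize 2 * cos (2 * Real.pi * p) = c at *
  generalize exp (-(2 * Real.pi * I * p ^ 2)) = K at *
  generalize exp (3 * Real.pi * I / 8) = W at *
  refine mul_left_cancel₀ hQ ?_
  linear_combination gaussSine 2 (2 * p) * a1 + X * h3 + X * Q * (h1 + h2) +
    Q * (Real.sqrt 2 / 2 : ℂ) * (a2 + a3) - Q * (Real.sqrt 2 / 2 : ℂ) * W * a4

theorem GaussDomOn.exp_mul_norm {φ : ℂ → ℂ} {S : Set ℂ} (h : GaussDomOn φ S) {B : ℝ} (hB : 0 ≤ B)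
    (c : ℝ) : GaussDomOn (fun x => ((Real.exp (B * (‖x‖ + c)) : ℝ) : ℂ) * φ x) S := by
  refine h.mul (C' := Real.exp (B * c)) (B' := B) (by positivity) hB fun x _ => ?_
  rw [norm_real, Real.norm_eq_abs, abs_of_pos (Real.exp_pos _), ← Real.exp_add]
  exact (by congr 1; ring : Real.exp _ = Real.exp _).le

theorem continuous_gaussSine {α : ℝ} (hα : 1 ≤ α) : Continuous (gaussSine α) := by
  rw [continuous_iff_continuousAt]
  intro p₀
  set R := ‖p₀‖ + 1 with hR
  have hB : 0 ≤ 2 * Real.pi * R := by positivity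
  have hcont : ∀ q : ℂ, Continuous fun u : ℝ => quadExp α q (1 / 2 + u * dirSE) := fun q =>
    (differentiable_quadExp α q).continuous.comp (by fun_prop)
  have hD : Continuous fun u : ℝ => expDiff (1 / 2 + u * dirSE) := by fun_prop
  have hdom := gaussDom_line_of_strip (a := 1 / 2)
    ((gaussDomOn_quadExp hα 0 (1 / 2)).exp_mul_norm hB 0) (by norm_num [abs_div])
  have hi := (hdom.integrable (by
    have := hcont 0
    push_cast
    exact Continuous.aestronglyMeasurable (by fun_prop))).norm
  refine continuousAt_of_dominated (F := fun p u =>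
      lineIntegrand (fun x => quadExp α p x / expDiff x) (1 / 2) dirSE u) ?_ ?_ hi ?_
  · refine Eventually.of_forall fun p => ((Continuous.div (hcont p) hD
      (expDiff_half_line_ne_zero (Or.inl rfl))).mul continuous_const).aestronglyMeasurable
  · filter_upwards [Metric.ball_mem_nhds p₀ one_pos] with p hp
    refine Eventually.of_forall fun u => ?_
    rw [lineIntegrand, norm_mul, norm_dirSE, mul_one, norm_div]
    refine (div_le_self (norm_nonneg _) (one_le_norm_expDiff_half_line (Or.inl rfl) u)).trans ?_
    push_cast
    generalize (1 / 2 + u * dirSE : ℂ) = x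
    have hp' : ‖p‖ ≤ R := by
      have := norm_sub_norm_le p p₀
      have h2 : ‖p - p₀‖ < 1 := by simpa [dist_eq_norm] using hp
      linarith
    rw [quadExp, quadExp, norm_mul, norm_mul, mul_zero, zero_mul, Complex.exp_zero, one_mul]
    refine mul_le_mul_of_nonneg_right ((Complex.norm_exp_le_exp_norm _).trans ?_) (norm_nonneg _)
    rw [Complex.norm_exp]
    refine Real.exp_le_exp.2 ?_
    have e1 : ‖2 * Real.pi * I * p * x‖ = 2 * Real.pi * ‖p‖ * ‖x‖ := by
      simp [abs_of_pos Real.pi_pos]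
    have e2 : ((2 * Real.pi * R * (‖x‖ + 0) : ℂ)).re = 2 * Real.pi * R * ‖x‖ := by
      rw [add_zero]; norm_cast
    rw [e1]
    refine le_of_le_of_eq ?_ e2.symm
    gcongr
  · refine Eventually.of_forall fun u => ?_
    simp only [lineIntegrand, quadExp]
    fun_prop (disch := exact expDiff_half_line_ne_zero (Or.inl rfl) u)

/-- The integral along `k ↘ k+1` of the leading Gaussian term. -/
theorem lineIntegral_gauss_div_expDiff (k : ℤ) (η : ℂ) :
    lineIntegral (fun x => exp (-(2 * Real.pi * I * (x - η) ^ 2)) / expDiff x) (k + 1 / 2) dirSE =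
      (-1) ^ k * (exp (-(2 * Real.pi * I * (η - k) ^ 2)) * gaussSine 2 (2 * (η - k))) := by
  rw [gaussSine, add_comm (k : ℂ), lineIntegral_add, ← mul_assoc, ← lineIntegral_const_mul]
  refine lineIntegral_congr fun u => ?_
  generalize (1 / 2 + u * dirSE : ℂ) = x
  have hs : ((-1 : ℂ) ^ k) * (-1) ^ k = 1 := by
    rw [← mul_zpow]; simp
  have hs' : ((-1 : ℂ) ^ k) ≠ 0 := zpow_ne_zero _ (by norm_num)
  rw [show expDiff (k + x) = (-1) ^ k * expDiff x by rw [add_comm, expDiff_add_intCast],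
    ← mul_div_mul_left _ _ hs', ← mul_assoc ((-1) ^ k) ((-1) ^ k) (expDiff x), hs, one_mul,
    quadExp]
  have e : exp (-(2 * Real.pi * I * (k + x - η) ^ 2)) = exp (-(2 * Real.pi * I * (η - k) ^ 2)) *
      (exp (2 * Real.pi * I * (2 * (η - k)) * x) * exp (-(Real.pi * I * (2 : ℝ) * x ^ 2))) := by
    rw [← Complex.exp_add, ← Complex.exp_add]
    congr 1; push_cast; ring
  rw [e]; ring

/-- Away from the zeros of the cosine the quotient is the Gaussian integral along k ↘ k+1, which is
continuous in η everywhere; hence the singularities are removable and the limit is that integral. -/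
theorem tendsto_riemannQuot (k : ℤ) (η : ℂ) : Tendsto (riemannQuot k) (𝓝[≠] η)
    (𝓝 (lineIntegral (fun x => exp (-(2 * Real.pi * I * (x - η) ^ 2)) / expDiff x)
      (k + 1 / 2) dirSE)) := by
  set J : ℂ → ℂ := fun z =>
    (-1) ^ k * (exp (-(2 * Real.pi * I * (z - k) ^ 2)) * gaussSine 2 (2 * (z - k))) with hJ
  have hJc : Continuous J := by
    have := continuous_gaussSine one_le_two
    fun_prop
  have hJq : ∀ z, cos (2 * Real.pi * z) ≠ 0 → riemannQuot k z = J z := by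
    intro z hz
    have h := two_cos_mul_gaussSine_two (z - k)
    have c1 : cos (2 * Real.pi * (z - k)) = cos (2 * Real.pi * z) := by
      rw [show 2 * Real.pi * (z - k) = 2 * Real.pi * z - k * (2 * Real.pi) by ring,
        Complex.cos_sub_int_mul_two_pi]
    have c2 : sin (Real.pi * (z - k)) = (-1) ^ k * sin (Real.pi * z) := by
      rw [show Real.pi * (z - k) = Real.pi * z - k * Real.pi by ring,
        Complex.sin_antiperiodic.sub_int_mul_eq]
      rcases k.even_or_odd with h | h
      · simp [Int.negOnePow_even _ h, h.neg_one_zpow]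
      · simp [Int.negOnePow_odd _ h, h.neg_one_zpow]
    have c3 : exp (2 * Real.pi * I * (z - k) - 2 * Real.pi * I * (z - k) ^ 2) =
        exp (2 * Real.pi * I * z - 2 * Real.pi * I * (z - k) ^ 2) := by
      rw [show 2 * Real.pi * I * (z - k) - 2 * Real.pi * I * (z - k) ^ 2 =
        2 * Real.pi * I * z - 2 * Real.pi * I * (z - k) ^ 2 - k * (2 * Real.pi * I) by ring,
        Complex.exp_sub, Complex.exp_int_mul_two_pi_mul_I, div_one]
    have hs : ((-1 : ℂ) ^ k) * (-1) ^ k = 1 := by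
      rw [← mul_zpow]; simp
    rw [c1, c2, c3] at h
    rw [riemannQuot, div_eq_iff (mul_ne_zero two_ne_zero hz), hJ]
    linear_combination (-(-1) ^ k) * h -
      (Real.sqrt 2 * exp (3 * Real.pi * I / 8) * sin (Real.pi * z)) * hs
  -- Sine and cosine have no common zero, so the zeros of the denominator are simple and isolated.
  have hev : ∀ᶠ z in 𝓝[≠] η, cos (2 * Real.pi * z) ≠ 0 := by
    by_cases h : cos (2 * Real.pi * η) = 0
    · have hd : HasDerivAt (fun z : ℂ => cos (2 * Real.pi * z))
          (-sin (2 * Real.pi * η) * (2 * Real.pi * 1)) η :=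
        ((hasDerivAt_id η).const_mul (2 * Real.pi : ℂ)).ccos
      refine hd.eventually_ne ?_
      have hs : sin (2 * Real.pi * η) ≠ 0 := fun h' => by
        have := Complex.sin_sq_add_cos_sq (2 * Real.pi * η)
        simp [h, h'] at this
      simpa [Real.pi_ne_zero] using hs
    · exact ((by fun_prop : Continuous fun z : ℂ => cos (2 * Real.pi * z)).continuousAt.eventually_ne
        h).filter_mono nhdsWithin_le_nhds
  rw [lineIntegral_gauss_div_expDiff]
  refine ((hJc.tendsto η).mono_left nhdsWithin_le_nhds).congr' ?_
  filter_upwards [hev] with z hz using (hJq z hz).symm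

theorem riemannTerm_eq (k : ℤ) (η : ℂ) : riemannTerm k η =
    lineIntegral (fun x => exp (-(2 * Real.pi * I * (x - η) ^ 2)) / expDiff x)
      (k + 1 / 2) dirSE :=
  (tendsto_riemannQuot k η).limUnder_eq

/-! ### Powers against Gaussian weights -/

/-- The 8 is 4 for -log‖x‖ ≤ 1/‖x‖ and 4 for |arg x| ≤ π. Powers thus have at most exponential
growth, which Gaussian domination absorbs. The paths keep distance at least 1/4 from 0. -/
theorem norm_log_le_norm_add {x : ℂ} (hx : 1 / 4 ≤ ‖x‖) : ‖log x‖ ≤ ‖x‖ + 8 := by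
  have h0 : 0 < ‖x‖ := by linarith
  have h1 := Real.log_le_sub_one_of_pos h0
  have h2 := Real.log_le_sub_one_of_pos (inv_pos.2 h0)
  rw [Real.log_inv] at h2
  have h3 : ‖x‖⁻¹ ≤ 4 := by
    rw [inv_le_comm₀ h0 (by norm_num)]; linarith
  have h4 := Complex.abs_arg_le_pi x
  have h5 := Real.pi_lt_four
  have h6 := Complex.norm_le_abs_re_add_abs_im (log x)
  rw [log_re, log_im] at h6
  have h7 : |Real.log ‖x‖| ≤ ‖x‖ + 4 := abs_le.2 ⟨by linarith, by linarith⟩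
  linarith

theorem norm_cpow_le_exp {x : ℂ} (hx : 1 / 4 ≤ ‖x‖) (s : ℂ) :
    ‖x ^ s‖ ≤ Real.exp (‖s‖ * (‖x‖ + 8)) := by
  have hx0 : x ≠ 0 := by
    rintro rfl
    norm_num at hx
  rw [cpow_def_of_ne_zero hx0]
  refine (Complex.norm_exp_le_exp_norm _).trans (Real.exp_le_exp.2 ?_)
  rw [norm_mul, mul_comm]
  exact mul_le_mul_of_nonneg_left (norm_log_le_norm_add hx) (norm_nonneg _)

theorem GaussDomOn.cpow_mul {φ : ℂ → ℂ} {S : Set ℂ} (h : GaussDomOn φ S)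
    (hS : ∀ x ∈ S, 1 / 4 ≤ ‖x‖) (s : ℂ) : GaussDomOn (fun x => x ^ s * φ x) S := by
  refine h.mul (C' := Real.exp (‖s‖ * 8)) (B' := ‖s‖) (by positivity) (norm_nonneg _)
    fun x hx => (norm_cpow_le_exp (hS x hx) s).trans (le_of_eq ?_)
  rw [← Real.exp_add]; congr 1; ring

theorem differentiable_lineIntegral_cpow {d : ℂ} (hd : d = dirSE ∨ d = dirSW) {φ : ℂ → ℂ}
    (hφc : Continuous φ) (hφ : GaussDomOn φ (Set.range fun u : ℝ => (1 / 2 + u * d : ℂ)))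
    (hS : ∀ u : ℝ, 1 / 4 ≤ ‖(1 / 2 + u * d : ℂ)‖) :
    Differentiable ℂ fun s : ℂ => lineIntegral (fun x => x ^ s * φ x / expDiff x) (1 / 2) d := by
  intro s₀
  have hd1 : ‖d‖ = 1 := by rcases hd with rfl | rfl; exacts [norm_dirSE, norm_dirSW]
  set R := ‖s₀‖ + 1 with hR
  have hx0 : ∀ u : ℝ, (1 / 2 + u * d : ℂ) ≠ 0 := fun u h => by
    have := hS u; rw [h] at this; norm_num at this
  have hD : Continuous fun u : ℝ => expDiff (1 / 2 + u * d) := by fun_prop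
  have hpow : ∀ s : ℂ, Measurable fun u : ℝ => (1 / 2 + u * d : ℂ) ^ s := fun s => by fun_prop
  have hlog : Measurable fun u : ℝ => log (1 / 2 + u * d : ℂ) := by fun_prop
  have hφm : Measurable fun u : ℝ => φ (1 / 2 + u * d) :=
    (hφc.comp (by fun_prop : Continuous fun u : ℝ => (1 / 2 + u * d : ℂ))).measurable
  have hmeas : ∀ s : ℂ, AEStronglyMeasurable
      (lineIntegrand (fun x => x ^ s * φ x / expDiff x) (1 / 2) d) := fun s =>
    ((((hpow s).mul hφm).div hD.measurable).mul_const d).aestronglyMeasurable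
  have hdom : ∀ C : ℝ, 0 ≤ C → Integrable fun u : ℝ =>
      ‖((Real.exp (C * (‖(1 / 2 + u * d : ℂ)‖ + 8)) : ℝ) : ℂ) * φ (1 / 2 + u * d)‖ := by
    intro C hC
    refine Integrable.norm (GaussDom.integrable
      ((hφ.exp_mul_norm hC 8).line (1 / 2) hd1 fun u => ⟨u, rfl⟩) ?_)
    have : Continuous fun u : ℝ => ((Real.exp (C * (‖(1 / 2 + u * d : ℂ)‖ + 8)) : ℝ) : ℂ) := by
      fun_prop
    exact (this.measurable.mul hφm).aestronglyMeasurable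
  have hnorm : ∀ (g : ℂ) (u : ℝ) (C : ℝ), ‖g‖ ≤ Real.exp (C * (‖(1 / 2 + u * d : ℂ)‖ + 8)) →
      ‖g * φ (1 / 2 + u * d) / expDiff (1 / 2 + u * d) * d‖ ≤
      ‖((Real.exp (C * (‖(1 / 2 + u * d : ℂ)‖ + 8)) : ℝ) : ℂ) * φ (1 / 2 + u * d)‖ := by
    intro g u C hg
    rw [norm_mul, hd1, mul_one, norm_div]
    refine (div_le_self (norm_nonneg _) (one_le_norm_expDiff_half_line hd u)).trans ?_
    rw [norm_mul, norm_mul, norm_real, Real.norm_eq_abs, abs_of_pos (Real.exp_pos _)]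
    exact mul_le_mul_of_nonneg_right hg (norm_nonneg _)
  refine (hasDerivAt_integral_of_dominated_loc_of_deriv_le
    (F := fun (s : ℂ) u => lineIntegrand (fun x => x ^ s * φ x / expDiff x) (1 / 2) d u)
    (F' := fun (s : ℂ) u => lineIntegrand (fun x => x ^ s * log x * φ x / expDiff x) (1 / 2) d u)
    (Metric.ball_mem_nhds s₀ one_pos) (Eventually.of_forall hmeas) ?_ ?_ ?_
    -- R bounds ‖s‖ on the unit ball around s₀; the extra 1 in the rate absorbs the logarithm
    -- produced by differentiating the power.
    (hdom (R + 1) (by positivity)) ?_).2.differentiableAt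
  · exact (hdom ‖s₀‖ (norm_nonneg _)).mono' (hmeas s₀) (Eventually.of_forall fun u =>
      hnorm _ u _ (norm_cpow_le_exp (hS u) s₀))
  · exact (((((hpow s₀).mul hlog).mul hφm).div hD.measurable).mul_const d).aestronglyMeasurable
  · refine Eventually.of_forall fun u s hs => hnorm _ u _ ?_
    have hs' : ‖s‖ ≤ R := by
      have := norm_sub_norm_le s s₀
      have h2 : ‖s - s₀‖ < 1 := by simpa [dist_eq_norm] using hs
      linarith
    rw [norm_mul, add_mul, Real.exp_add, one_mul]
    refine mul_le_mul ((norm_cpow_le_exp (hS u) s).trans (Real.exp_le_exp.2 ?_))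
      ((norm_log_le_norm_add (hS u)).trans ?_) (norm_nonneg _) (Real.exp_pos _).le
    · exact mul_le_mul_of_nonneg_right hs' (by positivity)
    · linarith [Real.add_one_le_exp (‖(1 / 2 + u * d : ℂ)‖ + 8)]
  · refine Eventually.of_forall fun u s _ => ?_
    simp only [lineIntegrand]
    have h1 : HasDerivAt (fun s : ℂ => (1 / 2 + u * d : ℂ) ^ s)
        ((1 / 2 + u * d : ℂ) ^ s * log (1 / 2 + u * d) * 1) s :=
      (hasDerivAt_id s).const_cpow (Or.inl (hx0 u))
    rw [mul_one] at h1
    exact ((h1.mul_const _).div_const _).mul_const _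

/-! ### The auxiliary integral and its reflection as entire functions of s -/

theorem norm_ge_of_re_add_im {x : ℂ} (h : 1 / 2 ≤ x.re + x.im) : 1 / 4 ≤ ‖x‖ := by
  have h1 := Complex.abs_re_le_norm x
  have h2 := Complex.abs_im_le_norm x
  have h3 := le_abs_self x.re
  have h4 := le_abs_self x.im
  linarith

theorem norm_ge_of_re_sub_im {x : ℂ} (h : 1 / 2 ≤ x.re - x.im) : 1 / 4 ≤ ‖x‖ := by
  have h1 := Complex.abs_re_le_norm x
  have h2 := Complex.abs_im_le_norm x
  have h3 := le_abs_self x.re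
  have h4 := neg_abs_le x.im
  linarith

theorem half_line_SE (u : ℝ) : (1 / 2 + u * dirSE : ℂ).re + (1 / 2 + u * dirSE : ℂ).im = 1 / 2 := by
  simpa using add_mul_dirSE_re_add_im (1 / 2) u

theorem half_line_SW (u : ℝ) : (1 / 2 + u * dirSW : ℂ).re - (1 / 2 + u * dirSW : ℂ).im = 1 / 2 := by
  simpa using add_mul_dirSW_re_sub_im (1 / 2) u

theorem gaussDomOn_exp_pi_I_sq (c : ℝ) :
    GaussDomOn (fun x => exp (Real.pi * I * x ^ 2)) {x | |x.re - x.im| ≤ c} := by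
  refine ⟨Real.exp (Real.pi * c ^ 2), 0, by positivity, le_rfl, fun x hx => ?_⟩
  have hn : ‖exp (Real.pi * I * x ^ 2)‖ =
      Real.exp (Real.pi * ((x.re - x.im) ^ 2 - ‖x‖ ^ 2)) := by
    rw [Complex.norm_exp, ← Complex.normSq_eq_norm_sq, Complex.normSq_apply]
    congr 1
    simp only [mul_re, mul_im, ofReal_re, ofReal_im, I_re, I_im, pow_two]
    ring
  rw [hn, ← Real.exp_add, Real.exp_le_exp]
  have h1 : (x.re - x.im) ^ 2 ≤ c ^ 2 := by
    rw [← sq_abs]; exact pow_le_pow_left₀ (abs_nonneg _) hx 2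
  nlinarith [sq_nonneg ‖x‖, Real.pi_gt_three]

/-- The reflected auxiliary function `∫_{0 ↘ 1} x^{s-1} e^{-π i x²} / (e^{π i x} - e^{-π i x}) dx`. -/
def dualAux (s : ℂ) : ℂ :=
  lineIntegral (fun x => x ^ (s - 1) * quadExp 1 0 x / expDiff x) (1 / 2) dirSE

theorem differentiable_dualAux : Differentiable ℂ dualAux := by
  have h := differentiable_lineIntegral_cpow (Or.inl rfl) (differentiable_quadExp 1 0).continuous
    ((gaussDomOn_quadExp le_rfl 0 (1 / 2)).mono ?_)
    (fun u => norm_ge_of_re_add_im (half_line_SE u).ge)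
  · exact h.comp (differentiable_id.sub_const 1)
  · rintro _ ⟨u, rfl⟩
    simp only [Set.mem_ofPred_eq, half_line_SE]
    norm_num [abs_div]

theorem gaussDomOn_exp_pi_I_sq_half_line : GaussDomOn (fun x => exp (Real.pi * I * x ^ 2))
    (Set.range fun u : ℝ => (1 / 2 + u * dirSW : ℂ)) := by
  refine (gaussDomOn_exp_pi_I_sq (1 / 2)).mono ?_
  rintro _ ⟨u, rfl⟩
  simp only [Set.mem_ofPred_eq, half_line_SW]
  norm_num [abs_div]

theorem differentiable_riemannAux : Differentiable ℂ riemannAux :=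
  (differentiable_lineIntegral_cpow (Or.inr rfl) (φ := fun x => exp (Real.pi * I * x ^ 2))
    (by fun_prop) gaussDomOn_exp_pi_I_sq_half_line
    (fun u => norm_ge_of_re_sub_im (half_line_SW u).ge)).comp differentiable_neg

theorem half_line_SW_mem_slitPlane (u : ℝ) : (1 / 2 + u * dirSW : ℂ) ∈ slitPlane := by
  rw [mem_slitPlane_iff]
  have := half_line_SW u
  by_contra! h
  linarith [h.1, h.2]

theorem integrable_auxIntegrand (s : ℂ) :
    Integrable (lineIntegrand (auxIntegrand s) (1 / 2) dirSW) := by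
  have h := (gaussDomOn_exp_pi_I_sq_half_line.cpow_mul (s := -s) ?_).line (1 / 2) norm_dirSW
    fun u => ⟨u, rfl⟩
  · have := integrable_lineIntegrand_of_gaussDom (Or.inr rfl) 0
      (φ := fun x => x ^ (-s) * exp (Real.pi * I * x ^ 2)) (by simpa using h) ?_
    · rwa [Int.cast_zero, zero_add] at this
    · rw [Int.cast_zero, zero_add]
      refine Continuous.mul (continuous_iff_continuousAt.2 fun u => ?_) (by fun_prop)
      exact ContinuousAt.cpow (by fun_prop) (by fun_prop) (half_line_SW_mem_slitPlane u)
  · rintro _ ⟨u, rfl⟩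
    exact norm_ge_of_re_sub_im (half_line_SW u).ge

/-! ### Moving the path of `riemannAux` to the origin -/

theorem differentiable_dslope_expDiff : Differentiable ℂ (dslope expDiff 0) := by
  rw [← differentiableOn_univ, differentiableOn_dslope univ_mem]
  exact differentiable_expDiff.differentiableOn

/-- Cancelling the zero of the denominator costs one power of x; for Re s < -1 the remaining power
still vanishes continuously at 0, so the path may pass through the origin. At x = 0 both sides are
0. -/
theorem auxIntegrand_eq_dslope {s : ℂ} (hs : s.re < -1) (x : ℂ) :
    auxIntegrand s x = x ^ (-s - 1) * exp (Real.pi * I * x ^ 2) / dslope expDiff 0 x := by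
  have e : auxIntegrand s x = x ^ (-s) * exp (Real.pi * I * x ^ 2) / expDiff x := rfl
  rcases eq_or_ne x 0 with rfl | hx0
  · have h1 : -s ≠ 0 := fun h => by
      have := congrArg re h
      simp at this; linarith
    have h2 : -s - 1 ≠ 0 := fun h => by
      have := congrArg re h
      simp at this; linarith
    rw [e, zero_cpow h1, zero_cpow h2]; simp
  · rw [e, dslope_of_ne _ hx0, slope_def_field, show expDiff 0 = 0 by simp [expDiff], sub_zero,
      sub_zero, cpow_sub _ _ hx0, cpow_one]
    field_simp

theorem GaussDom.of_continuous {h : ℝ → ℂ} (hc : Continuous h) {C B T : ℝ}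
    (hb : ∀ u, T ≤ |u| → ‖h u‖ ≤ C * Real.exp (B * |u| - u ^ 2)) : GaussDom h := by
  obtain ⟨M, hM⟩ := (isCompact_Icc (a := -|T|) (b := |T|)).exists_bound_of_continuousOn
    (hc.continuousOn)
  have hM0 : 0 ≤ M := (norm_nonneg _).trans (hM 0 (by simp))
  refine ⟨|C| + M * Real.exp (|B| * |T| + T ^ 2), B, fun u => ?_⟩
  have hp := Real.exp_pos (B * |u| - u ^ 2)
  rw [add_mul]
  rcases le_or_gt T |u| with hu | hu
  · have h1 := hb u hu
    have h2 := mul_le_mul_of_nonneg_right (le_abs_self C) hp.le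
    have h3 : 0 ≤ M * Real.exp (|B| * |T| + T ^ 2) * Real.exp (B * |u| - u ^ 2) := by positivity
    linarith
  · have hT : |u| ≤ |T| := hu.le.trans (le_abs_self T)
    have h1 := hM u (abs_le.1 hT)
    have h3 : 0 ≤ |C| * Real.exp (B * |u| - u ^ 2) := by positivity
    have h4 : 1 ≤ Real.exp (|B| * |T| + T ^ 2) * Real.exp (B * |u| - u ^ 2) := by
      rw [← Real.exp_add]
      refine Real.one_le_exp ?_
      have h5 : u ^ 2 ≤ T ^ 2 := sq_le_sq.2 hT
      have h6 : -(|B| * |T|) ≤ B * |u| := by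
        have := mul_le_mul_of_nonneg_left hT (abs_nonneg B)
        nlinarith [neg_abs_le B, abs_nonneg u]
      linarith
    nlinarith

theorem neg_dirSW_mul_re (z : ℂ) : (-dirSW * z).re = Real.sqrt 2 / 2 * (z.re - z.im) := by
  rw [mul_re, neg_re, neg_im, dirSW_re, dirSW_im]; ring

theorem neg_dirSW_mul_im (z : ℂ) : (-dirSW * z).im = Real.sqrt 2 / 2 * (z.re + z.im) := by
  rw [mul_im, neg_re, neg_im, dirSW_re, dirSW_im]; ring

/-- After rotation by `-dirSW` the region 0 ≤ Re x - Im x ≤ 1/2 is the strip -r/2 ≤ Im z ≤ 0. It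
contains no integer except 0, and it avoids the negative axis, so the principal power is continuous
on it. -/
theorem integrable_and_riemannAux_eq {s : ℂ} (hs : s.re < -1) :
    (Integrable fun u : ℝ => auxIntegrand s (-dirSW * u)) ∧
      riemannAux s = dirSW * ∫ u : ℝ, auxIntegrand s (-dirSW * u) := by
  set r : ℝ := Real.sqrt 2 / 2 with hr
  have hr0 : 0 < r := by positivity
  have hr2 : r ^ 2 = 1 / 2 := sqrt_two_div_two_sq
  have hr1 : r < 1 := by nlinarith
  set F : ℂ → ℂ := fun z => auxIntegrand s (-dirSW * z) with hF
  have hsub : ∀ z : ℂ, (-dirSW * z).re - (-dirSW * z).im = -2 * r * z.im := by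
    intro z; rw [neg_dirSW_mul_re, neg_dirSW_mul_im]; ring
  have hz2 : ∀ z : ℂ, -(r / 2) ≤ z.im → z.im ≤ 0 → 0 ≤ -2 * r * z.im ∧ -2 * r * z.im ≤ 1 / 2 := by
    intro z h1 h2
    constructor <;> nlinarith
  have hE : ∀ z : ℂ, -(r / 2) ≤ z.im → z.im ≤ 0 → -dirSW * z ≠ 0 → expDiff (-dirSW * z) ≠ 0 := by
    intro z h1 h2 h0 h
    obtain ⟨n, hn⟩ := expDiff_eq_zero_iff.1 h
    have h3 := hsub z
    have h4 := hz2 z h1 h2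
    rw [← h3, hn] at h4
    simp only [intCast_re, intCast_im, sub_zero] at h4
    have h5 : (0 : ℤ) ≤ n := by exact_mod_cast h4.1
    have h6 : n < 1 := by
      have : (n : ℝ) < 1 := by linarith [h4.2]
      exact_mod_cast this
    have h7 : n = 0 := by omega
    exact h0 (by rw [hn, h7, Int.cast_zero])
  have hFe : F = fun z => (-dirSW * z) ^ (-s - 1) * exp (Real.pi * I * (-dirSW * z) ^ 2) /
      dslope expDiff 0 (-dirSW * z) := funext fun z => auxIntegrand_eq_dslope hs _
  have hFc : ContinuousOn F {z | -(r / 2) ≤ z.im ∧ z.im ≤ 0} := by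
    intro z hz
    refine ContinuousAt.continuousWithinAt ?_
    rw [hFe]
    have hslit : 0 ≤ (-dirSW * z).re ∨ (-dirSW * z).im ≠ 0 := by
      by_contra! h
      linarith [hsub z, (hz2 z hz.1 hz.2).1, h.1, h.2]
    have h1 : ContinuousAt (fun x : ℂ => x ^ (-s - 1)) (-dirSW * z) :=
      continuousAt_cpow_const_of_re_pos hslit (by simp; linarith)
    have h2 : ContinuousAt (fun z : ℂ => (-dirSW * z) ^ (-s - 1)) z :=
      h1.comp (f := fun z : ℂ => -dirSW * z) (by fun_prop)
    have h3 : ContinuousAt (fun z : ℂ => dslope expDiff 0 (-dirSW * z)) z :=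
      (differentiable_dslope_expDiff.continuous.comp (by fun_prop)).continuousAt
    exact (h2.mul (by fun_prop)).div h3 (dslope_expDiff_ne_zero (hE z hz.1 hz.2))
  have hFd : DifferentiableOn ℂ F {z | -(r / 2) < z.im ∧ z.im < 0} := by
    intro z hz
    refine DifferentiableAt.differentiableWithinAt ?_
    rw [hFe]
    have hslit : -dirSW * z ∈ slitPlane := by
      rw [mem_slitPlane_iff]
      by_contra! h
      have h3 : 0 < -2 * r * z.im := by nlinarith [hz.2]
      linarith [hsub z, h.1, h.2]
    have h2 : DifferentiableAt ℂ (fun z : ℂ => (-dirSW * z) ^ (-s - 1)) z :=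
      DifferentiableAt.cpow_const (by fun_prop) hslit
    have h3 : DifferentiableAt ℂ (fun z : ℂ => dslope expDiff 0 (-dirSW * z)) z :=
      (differentiable_dslope_expDiff.comp (by fun_prop)).differentiableAt
    exact (h2.mul (by fun_prop)).div h3 (dslope_expDiff_ne_zero (hE z hz.1.le hz.2.le))
  obtain ⟨C, B, hC, hB, hb⟩ := ((gaussDomOn_exp_pi_I_sq (1 / 2)).mono
    (fun x hx => hx.1 : {x : ℂ | |x.re - x.im| ≤ 1 / 2 ∧ 1 / 4 ≤ ‖x‖} ⊆ _)).cpow_mul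
    (fun x hx => hx.2) (-s)
  have hbound : ∀ z : ℂ, -(r / 2) ≤ z.im → z.im ≤ 0 → 3 ≤ |z.re| →
      ‖F z‖ ≤ C * Real.exp B * Real.exp (B * |z.re| - z.re ^ 2) := by
    intro z h1 h2 h3
    have hn : ‖-dirSW * z‖ = ‖z‖ := by rw [norm_mul, norm_neg, norm_dirSW, one_mul]
    have him : |z.im| ≤ 1 := abs_le.2 ⟨by linarith, by linarith⟩
    have hexp : 1 ≤ ‖expDiff (-dirSW * z)‖ := by
      apply one_le_norm_expDiff
      rw [neg_dirSW_mul_im, abs_mul, abs_of_pos hr0]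
      have := abs_sub_abs_le_abs_sub z.re (-z.im)
      rw [abs_neg, sub_neg_eq_add] at this
      nlinarith
    have hnz : 3 ≤ ‖z‖ := h3.trans (Complex.abs_re_le_norm z)
    have h5 := hb (-dirSW * z) ⟨by
      rw [hsub, abs_of_nonneg (hz2 z h1 h2).1]; exact (hz2 z h1 h2).2, by rw [hn]; linarith⟩
    rw [hn] at h5
    have e : F z = (-dirSW * z) ^ (-s) * exp (Real.pi * I * (-dirSW * z) ^ 2) /
      expDiff (-dirSW * z) := rfl
    rw [e, norm_div]
    refine (div_le_self (norm_nonneg _) hexp).trans (h5.trans ?_)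
    rw [mul_assoc, ← Real.exp_add]
    refine mul_le_mul_of_nonneg_left (Real.exp_le_exp.2 ?_) hC
    have h6 := Complex.norm_le_abs_re_add_abs_im z
    have h7 : z.re ^ 2 ≤ ‖z‖ ^ 2 := by
      rw [← Complex.normSq_eq_norm_sq, Complex.normSq_apply]; nlinarith [sq_nonneg z.im]
    nlinarith [mul_le_mul_of_nonneg_left (h6.trans (add_le_add_right him _)) hB]
  have hint : ∀ y : ℝ, -(r / 2) ≤ y → y ≤ 0 → Integrable fun u : ℝ => F (u + y * I) := by
    intro y h1 h2
    have hc : Continuous fun u : ℝ => F (u + y * I) :=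
      hFc.comp_continuous (by fun_prop) fun u => by simp [h1, h2]
    refine (GaussDom.of_continuous hc (T := 3) (C := C * Real.exp B) (B := B) fun u hu => ?_).integrable hc.aestronglyMeasurable
    simpa using hbound (u + y * I) (by simpa using h1) (by simpa using h2) (by simpa using hu)
  have hshift := horizontalIntegral_eq_of_differentiableOn (by linarith : -(r / 2) ≤ 0) hFc hFd
    hbound (hint _ le_rfl (by linarith)) (hint 0 (by linarith) le_rfl)
  have hi0 := hint 0 (by linarith) le_rfl
  have e0 : ∀ u : ℝ, F (u + (0 : ℝ) * I) = auxIntegrand s (-dirSW * u) := fun u => by simp [hF]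
  refine ⟨hi0.congr (Eventually.of_forall e0), ?_⟩
  rw [← integral_congr_ae (Eventually.of_forall e0),
    show ∫ u : ℝ, F (u + (0 : ℝ) * I) = horizontalIntegral F 0 from rfl, ← hshift, riemannAux,
    -- The two parametrisations of the lower edge run in opposite directions, with origins r/2
    -- apart.
    lineIntegral, horizontalIntegral, ← integral_const_mul, ← integral_neg_eq_self,
    ← integral_add_right_eq_self (μ := volume) _ (-(r / 2))]
  refine integral_congr_ae (Eventually.of_forall fun u => ?_)
  simp only [lineIntegrand, hF]
  rw [mul_comm]
  congr 2
  have hw : dirSW * r * (1 - I) = -1 := by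
    rw [dirSW_eq]
    have := sqrt_two_div_two_sq'
    rw [← hr] at this ⊢
    linear_combination (I ^ 2 - 1) * this + (1 / 2) * I_sq
  push_cast
  linear_combination (1 / 2) * hw

/-! ### Rays, and the functional equation to the left of `-1` -/

theorem neg_dirSW_eq_exp : -dirSW = exp ((Real.pi / 4 : ℝ) * I) := by
  rw [dirSW, show (5 * Real.pi * I / 4 : ℂ) = (Real.pi / 4 : ℝ) * I + Real.pi * I by
      push_cast; ring, Complex.exp_add, exp_pi_mul_I]
  ring

theorem dirSW_eq_exp : dirSW = exp ((-(3 * Real.pi / 4) : ℝ) * I) := by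
  rw [dirSW, show (5 * Real.pi * I / 4 : ℂ) = (-(3 * Real.pi / 4) : ℝ) * I + 2 * Real.pi * I by
      push_cast; ring, Complex.exp_add, exp_two_pi_mul_I, mul_one]

theorem dirSE_eq_neg_I_mul : dirSE = -I * -dirSW := by
  rw [neg_dirSW_eq_exp, dirSE, ← Complex.exp_neg_pi_div_two_mul_I, ← Complex.exp_add]
  congr 1; push_cast; ring

theorem exp_mul_I_mul_ofReal_cpow {θ u : ℝ} (h1 : -Real.pi < θ) (h2 : θ ≤ Real.pi) (hu : 0 < u)
    (w : ℂ) : (exp (θ * I) * u) ^ w = (u : ℂ) ^ w * exp (θ * I * w) := by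
  have hu' : (u : ℂ) ≠ 0 := by exact_mod_cast hu.ne'
  rw [mul_comm, cpow_def_of_ne_zero (mul_ne_zero hu' (exp_ne_zero _)),
    log_ofReal_mul hu (exp_ne_zero _), log_exp (by simpa using h1) (by simpa using h2),
    cpow_def_of_ne_zero hu', ← Complex.exp_add, ofReal_log hu.le]
  congr 1; ring

theorem dirSE_mul_re (x : ℂ) : (dirSE * x).re = Real.sqrt 2 / 2 * (x.re + x.im) := by
  rw [mul_re, dirSE_re, dirSE_im]; ring

/-- The half-plane Re x + Im x > 0 is rotated onto Re > 0, so arguments lie in (-π/4, 3π/4) and no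
branch jump occurs. -/
theorem log_eq_of_re_add_im_pos {x : ℂ} (hx : 0 < x.re + x.im) :
    log x = log (dirSE * x) + (Real.pi / 4 : ℝ) * I := by
  have hre : 0 < (dirSE * x).re := by rw [dirSE_mul_re]; positivity
  have h0 : dirSE * x ≠ 0 := fun h => by rw [h] at hre; simp at hre
  have harg := abs_lt.1 (abs_arg_lt_pi_div_two_iff.2 (Or.inl hre))
  have him : (log (dirSE * x) + (Real.pi / 4 : ℝ) * I).im = arg (dirSE * x) + Real.pi / 4 := by
    simp [log_im]
  have hpi := Real.pi_pos
  rw [← log_exp (x := log (dirSE * x) + (Real.pi / 4 : ℝ) * I) (by rw [him]; linarith [harg.1])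
    (by rw [him]; linarith [harg.2]), Complex.exp_add, exp_log h0, dirSE, mul_right_comm,
    ← Complex.exp_add]
  congr 1
  rw [show -(Real.pi * I / 4) + ((Real.pi / 4 : ℝ) : ℂ) * I = 0 by push_cast; ring,
    Complex.exp_zero, one_mul]

theorem two_pi_mul_dirSE_mul_cpow {x : ℂ} (hx : 0 < x.re + x.im) (w : ℂ) :
    (2 * Real.pi * (dirSE * x)) ^ w =
      (2 * Real.pi : ℂ) ^ w * exp (-(Real.pi * I / 4) * w) * x ^ w := by
  have hp : (0 : ℝ) < 2 * Real.pi := by positivity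
  have hx0 : x ≠ 0 := by rintro rfl; simp at hx
  have h0 : dirSE * x ≠ 0 := mul_ne_zero dirSE_ne_zero hx0
  have hp' : ((2 * Real.pi : ℝ) : ℂ) ≠ 0 := by exact_mod_cast hp.ne'
  rw [show (2 * Real.pi : ℂ) = ((2 * Real.pi : ℝ) : ℂ) by push_cast; ring,
    cpow_def_of_ne_zero (mul_ne_zero hp' h0), log_ofReal_mul hp h0,
    cpow_def_of_ne_zero hx0, cpow_def_of_ne_zero hp', ← Complex.exp_add, ← Complex.exp_add,
    log_eq_of_re_add_im_pos hx, ofReal_log hp.le]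
  congr 1; push_cast; ring

/-- The rays have arguments π/4 and -3π/4. The principal power gives them the two phases, and the
odd denominator the relative minus sign. -/
theorem riemannAux_eq_integral_Ioi {s : ℂ} (hs : s.re < -1) :
    IntegrableOn (fun u : ℝ => (u : ℂ) ^ (-s) *
      (exp (Real.pi * I * (-dirSW * u) ^ 2) / expDiff (-dirSW * u))) (Set.Ioi 0) ∧
    riemannAux s = dirSW * (exp (-(Real.pi * I * s / 4)) - exp (3 * Real.pi * I * s / 4)) *
      ∫ u : ℝ in Set.Ioi 0, (u : ℂ) ^ (-s) *
        (exp (Real.pi * I * (-dirSW * u) ^ 2) / expDiff (-dirSW * u)) := by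
  obtain ⟨hi, he⟩ := integrable_and_riemannAux_eq hs
  have hpi := Real.pi_pos
  set f : ℝ → ℂ := fun u => (u : ℂ) ^ (-s) *
    (exp (Real.pi * I * (-dirSW * u) ^ 2) / expDiff (-dirSW * u)) with hf
  have h1 : ∀ u : ℝ, 0 < u → auxIntegrand s (-dirSW * u) = exp (-(Real.pi * I * s / 4)) * f u := by
    intro u hu
    have e : auxIntegrand s (-dirSW * u) = (-dirSW * u) ^ (-s) *
      exp (Real.pi * I * (-dirSW * u) ^ 2) / expDiff (-dirSW * u) := rfl
    have e2 : (-dirSW * u) ^ (-s) = (u : ℂ) ^ (-s) * exp (-(Real.pi * I * s / 4)) := by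
      rw [neg_dirSW_eq_exp, exp_mul_I_mul_ofReal_cpow (by linarith) (by linarith) hu]
      congr 2; push_cast; ring
    rw [e, e2]; simp only [hf]; ring
  have h2 : ∀ u : ℝ, 0 < u →
      auxIntegrand s (-dirSW * (-u : ℝ)) = -exp (3 * Real.pi * I * s / 4) * f u := by
    intro u hu
    have e : auxIntegrand s (-dirSW * (-u : ℝ)) = (dirSW * u) ^ (-s) *
        exp (Real.pi * I * (-dirSW * u) ^ 2) / expDiff (-(-dirSW * u)) := by
      rw [show -dirSW * ((-u : ℝ) : ℂ) = dirSW * u by push_cast; ring,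
        show -(-dirSW * u) = dirSW * u by ring, show (-dirSW * u) ^ 2 = (dirSW * u) ^ 2 by ring]
      rfl
    have e2 : (dirSW * u) ^ (-s) = (u : ℂ) ^ (-s) * exp (3 * Real.pi * I * s / 4) := by
      rw [dirSW_eq_exp, exp_mul_I_mul_ofReal_cpow (by linarith) (by linarith) hu]
      congr 2; push_cast; ring
    rw [e, e2, expDiff_neg]; simp only [hf]; ring
  have hf_int : IntegrableOn f (Set.Ioi 0) := by
    refine (hi.integrableOn.const_mul (exp (Real.pi * I * s / 4))).congr ?_
    filter_upwards [ae_restrict_mem measurableSet_Ioi] with u hu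
    rw [h1 u hu, ← mul_assoc, ← Complex.exp_add, add_neg_cancel, Complex.exp_zero, one_mul]
  refine ⟨hf_int, ?_⟩
  rw [he, ← intervalIntegral.integral_Iic_add_Ioi hi.integrableOn hi.integrableOn (b := 0)]
  have e3 : ∫ u : ℝ in Set.Iic 0, auxIntegrand s (-dirSW * u) =
      ∫ u : ℝ in Set.Ioi 0, auxIntegrand s (-dirSW * (-u : ℝ)) := by
    have := integral_comp_neg_Ioi 0 fun u : ℝ => auxIntegrand s (-dirSW * u)
    rw [neg_zero] at this
    exact this.symm
  rw [e3, setIntegral_congr_fun measurableSet_Ioi h1, setIntegral_congr_fun measurableSet_Ioi h2,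
    integral_const_mul, integral_const_mul]
  ring

/-- For p on the ray, e^{2πipx} = e^{-2π(dirSE·x)u}; Fubini leaves a Gamma integral whose complex
rate supplies the power x^{s-1} of `dualAux`. -/
theorem integral_cpow_mul_gaussSine {s : ℂ} (hs : s.re < 1) :
    IntegrableOn (fun u : ℝ => (u : ℂ) ^ (-s) * gaussSine 1 (-dirSW * u)) (Set.Ioi 0) ∧
    ∫ u : ℝ in Set.Ioi 0, (u : ℂ) ^ (-s) * gaussSine 1 (-dirSW * u) =
      (2 * Real.pi : ℂ) ^ (s - 1) * exp (-(Real.pi * I / 4) * (s - 1)) * Gamma (1 - s) *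
        dualAux s := by
  have hpi := Real.pi_pos
  set X : ℝ → ℂ := fun v => 1 / 2 + v * dirSE with hX
  set A : ℝ → ℂ := fun v => quadExp 1 0 (X v) / expDiff (X v) * dirSE with hA
  have hAi : Integrable A := by
    have := integrable_quadExp_div le_rfl 0 0
    rw [Int.cast_zero, zero_add] at this
    exact this
  set Φ : ℝ → ℝ → ℂ := fun u v => (u : ℂ) ^ (-s) * (exp (-(2 * Real.pi * (dirSE * X v) * u)) * A v)
    with hΦ
  have hΦe : ∀ u : ℝ, (u : ℂ) ^ (-s) * gaussSine 1 (-dirSW * u) = ∫ v, Φ u v := by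
    intro u
    rw [gaussSine, lineIntegral, ← integral_const_mul]
    refine integral_congr_ae (Eventually.of_forall fun v => ?_)
    simp only [lineIntegrand, hΦ, hA, quadExp]
    rw [show 2 * Real.pi * I * (-dirSW * u) * (1 / 2 + v * dirSE) =
      -(2 * Real.pi * (dirSE * X v) * u) + 2 * Real.pi * I * 0 * X v by
        rw [dirSE_eq_neg_I_mul]; simp only [hX]; rw [dirSE_eq_neg_I_mul]; ring, Complex.exp_add]
    ring
  -- The real part of the rate is constant along the path, so the double integrand is majorised by a
  -- product.
  have hre : ∀ v, (2 * Real.pi * (dirSE * X v)).re = Real.pi * (Real.sqrt 2 / 2) := by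
    intro v
    rw [show (2 * Real.pi : ℂ) = ((2 * Real.pi : ℝ) : ℂ) by push_cast; ring, re_ofReal_mul,
      dirSE_mul_re, half_line_SE]
    ring
  have hΦn : ∀ u v : ℝ, 0 < u →
      ‖Φ u v‖ = u ^ (-s.re) * Real.exp (-(Real.pi * (Real.sqrt 2 / 2)) * u) * ‖A v‖ := by
    intro u v hu
    simp only [hΦ]
    rw [norm_mul, norm_mul, Complex.norm_cpow_eq_rpow_re_of_pos hu, Complex.norm_exp, neg_re, neg_re,
      re_mul_ofReal, hre, neg_mul]
    ring
  have hmeas : Measurable (Function.uncurry Φ) := by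
    have h1 : Measurable fun z : ℝ × ℝ => (z.1 : ℂ) ^ (-s) := by fun_prop
    have h2 : Continuous fun z : ℝ × ℝ => exp (-(2 * Real.pi * (dirSE * X z.2) * z.1)) := by
      simp only [hX]; fun_prop
    have h3 : Measurable A := by
      have a1 : Continuous fun v => quadExp 1 0 (X v) :=
        (differentiable_quadExp 1 0).continuous.comp (by fun_prop)
      have a2 : Continuous fun v => expDiff (X v) := by fun_prop
      exact (a1.measurable.div a2.measurable).mul_const _
    exact h1.mul (h2.measurable.mul (h3.comp measurable_snd))
  have hint1 : IntegrableOn (fun u : ℝ => u ^ (-s.re) *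
      Real.exp (-(Real.pi * (Real.sqrt 2 / 2)) * u)) (Set.Ioi 0) := by
    simpa using integrableOn_rpow_mul_exp_neg_mul_rpow (s := -s.re) (p := 1) (by linarith) one_pos
      (b := Real.pi * (Real.sqrt 2 / 2)) (by positivity)
  have hprod : Integrable (Function.uncurry Φ) ((volume.restrict (Set.Ioi 0)).prod volume) := by
    refine (Integrable.mul_prod (μ := volume.restrict (Set.Ioi (0 : ℝ))) hint1 hAi.norm).mono'
      hmeas.aestronglyMeasurable ?_
    filter_upwards [Measure.quasiMeasurePreserving_fst.ae (ae_restrict_mem measurableSet_Ioi)]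
      with z hz
    exact (hΦn z.1 z.2 hz).le
  refine ⟨(hprod.integral_prod_left).congr (Eventually.of_forall fun u => (hΦe u).symm), ?_⟩
  simp only [hΦe]
  rw [integral_integral_swap hprod, dualAux, lineIntegral, ← integral_const_mul]
  refine integral_congr_ae (Eventually.of_forall fun v => ?_)
  have hx : 0 < (X v).re + (X v).im := by rw [half_line_SE]; norm_num
  have hg := integral_cpow_mul_exp_neg_complex_mul_Ioi (a := 1 - s)
    (r := 2 * Real.pi * (dirSE * X v)) (by simpa using hs) (by rw [hre]; positivity)
  have e1 : ∫ u : ℝ in Set.Ioi 0, Φ u v = (∫ u : ℝ in Set.Ioi 0, (u : ℂ) ^ (1 - s - 1) *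
      exp (-(2 * Real.pi * (dirSE * X v) * u))) * A v := by
    rw [← integral_mul_const]
    refine integral_congr_ae (Eventually.of_forall fun u => ?_)
    simp only [hΦ]
    rw [show 1 - s - 1 = -s by ring]
    ring
  simp only [lineIntegrand]
  rw [e1, hg, show -(1 - s) = s - 1 by ring, two_pi_mul_dirSE_mul_cpow hx]
  simp only [hA, hX]
  ring

/-- The geometric series in q = e^{-ρ₀u} is integrated termwise; Re(1-s) > 1 makes both the
interchange and the zeta series converge. -/
theorem integral_cpow_div_exp_sub_one {s : ℂ} (hs : s.re < 0) :
    ∫ u : ℝ in Set.Ioi 0, (u : ℂ) ^ (-s) * (1 / (exp (-(2 * Real.pi * I * (-dirSW * u))) - 1)) =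
      (2 * Real.pi : ℂ) ^ (s - 1) * exp (-(Real.pi * I / 4) * (s - 1)) * Gamma (1 - s) *
        riemannZeta (1 - s) := by
  have hpi := Real.pi_pos
  set r : ℝ := Real.sqrt 2 / 2 with hr
  have hr0 : 0 < r := by positivity
  set ρ : ℕ → ℂ := fun n => 2 * Real.pi * (dirSE * (n + 1 : ℂ)) with hρ
  have hre : ∀ n : ℕ, (ρ n).re = 2 * Real.pi * r * (n + 1) := by
    intro n
    simp only [hρ]
    rw [show (2 * Real.pi : ℂ) = ((2 * Real.pi : ℝ) : ℂ) by push_cast; ring, re_ofReal_mul,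
      dirSE_mul_re]
    simp; ring
  have hre0 : ∀ n : ℕ, 0 < (ρ n).re := fun n => by rw [hre]; positivity
  set F : ℕ → ℝ → ℂ := fun n u => (u : ℂ) ^ (1 - s - 1) * exp (-(ρ n * u)) with hF
  have hnorm : ∀ (n : ℕ) (u : ℝ), 0 < u →
      ‖F n u‖ = u ^ (1 - s.re - 1) * Real.exp (-((ρ n).re * u)) := by
    intro n u hu
    simp only [hF]
    rw [norm_mul, Complex.norm_cpow_eq_rpow_re_of_pos hu, Complex.norm_exp, neg_re, re_mul_ofReal]
    simp
  have hmeas : ∀ n, AEStronglyMeasurable (F n) (volume.restrict (Set.Ioi 0)) := fun n => by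
    have : Measurable fun u : ℝ => (u : ℂ) ^ (1 - s - 1) := by fun_prop
    exact (this.mul (by fun_prop)).aestronglyMeasurable
  have hFi : ∀ n, Integrable (F n) (volume.restrict (Set.Ioi 0)) := by
    intro n
    have h := integrableOn_rpow_mul_exp_neg_mul_rpow (s := 1 - s.re - 1) (p := 1) (by linarith)
      one_pos (hre0 n)
    refine Integrable.mono' h (hmeas n) ?_
    filter_upwards [ae_restrict_mem measurableSet_Ioi] with u hu
    rw [hnorm n u hu, Real.rpow_one, neg_mul]
  have hsum : Summable fun n => ∫ u : ℝ in Set.Ioi 0, ‖F n u‖ := by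
    have e : ∀ n : ℕ, ∫ u : ℝ in Set.Ioi 0, ‖F n u‖ = (1 / (2 * Real.pi * r)) ^ (1 - s.re) *
        Real.Gamma (1 - s.re) * (1 / ((n + 1 : ℕ) : ℝ) ^ (1 - s.re)) := by
      intro n
      rw [setIntegral_congr_fun measurableSet_Ioi (hnorm n),
        Real.integral_rpow_mul_exp_neg_mul_Ioi (by linarith) (hre0 n), hre,
        Nat.cast_add_one, ← one_div_mul_one_div,
        Real.mul_rpow (by positivity) (by positivity), Real.div_rpow one_pos.le (by positivity) (1 - s.re) (y := (n + 1 : ℝ)), Real.one_rpow]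
      ring
    simp only [e]
    exact ((summable_nat_add_iff 1).2 (Real.summable_one_div_nat_rpow.2 (by linarith))).mul_left _
  have h := hasSum_integral_of_summable_integral_norm hFi hsum
  have e1 : ∀ n, ∫ u : ℝ in Set.Ioi 0, F n u = (2 * Real.pi : ℂ) ^ (s - 1) *
      exp (-(Real.pi * I / 4) * (s - 1)) * Gamma (1 - s) * (1 / (n + 1 : ℂ) ^ (1 - s)) := by
    intro n
    have hx : 0 < (n + 1 : ℂ).re + (n + 1 : ℂ).im := by simp; positivity
    rw [integral_cpow_mul_exp_neg_complex_mul_Ioi (by simp; linarith) (hre0 n)]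
    simp only [hρ]
    rw [two_pi_mul_dirSE_mul_cpow hx, show -(1 - s) = s - 1 by ring,
      show (n + 1 : ℂ) ^ (s - 1) = 1 / (n + 1 : ℂ) ^ (1 - s) by
        rw [one_div, ← cpow_neg, neg_sub]]
    ring
  have e2 : ∫ u : ℝ in Set.Ioi 0, ∑' n, F n u = ∫ u : ℝ in Set.Ioi 0,
      (u : ℂ) ^ (-s) * (1 / (exp (-(2 * Real.pi * I * (-dirSW * u))) - 1)) := by
    refine setIntegral_congr_fun measurableSet_Ioi fun u hu => ?_
    have hu0 : 0 < u := hu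
    set q := exp (-(ρ 0 * u)) with hq
    have hq1 : ‖q‖ < 1 := by
      rw [hq, Complex.norm_exp, neg_re, re_mul_ofReal, Real.exp_lt_one_iff]
      have := mul_pos (hre0 0) hu0
      linarith
    have hq0 : q ≠ 0 := exp_ne_zero _
    have e3 : ∀ n, F n u = (u : ℂ) ^ (-s) * q * q ^ n := by
      intro n
      have e5 : exp (-(ρ n * u)) = q * q ^ n := by
        rw [hq, ← Complex.exp_nat_mul, ← Complex.exp_add]
        congr 1
        simp only [hρ]; push_cast; ring
      simp only [hF]
      rw [e5, show 1 - s - 1 = -s by ring, mul_assoc]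
    have e4 : exp (-(2 * Real.pi * I * (-dirSW * u))) = q⁻¹ := by
      rw [hq, ← Complex.exp_neg, neg_neg]
      congr 1
      simp only [hρ]
      rw [dirSE_eq_neg_I_mul]; push_cast; ring
    have hq2 : 1 - q ≠ 0 := fun h => by
      rw [sub_eq_zero] at h; rw [← h] at hq1; simp at hq1
    show ∑' n, F n u = _
    simp only [e3]
    rw [tsum_mul_left, tsum_geometric_of_norm_lt_one hq1, e4, mul_assoc,
      show q⁻¹ - 1 = (1 - q) / q by field_simp]
    congr 1
    field_simp
  rw [← e2, ← h.tsum_eq, tsum_congr e1, tsum_mul_left,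
    zeta_eq_tsum_one_div_nat_add_one_cpow (by simp; linarith)]

theorem two_cpow_mul_pi_cpow (s : ℂ) :
    (2 : ℂ) ^ s * (Real.pi : ℂ) ^ (s - 1) = 2 * (2 * Real.pi : ℂ) ^ (s - 1) := by
  rw [show (2 * Real.pi : ℂ) = ((2 : ℝ) : ℂ) * ((Real.pi : ℝ) : ℂ) by push_cast; ring,
    mul_cpow_ofReal_nonneg (by norm_num) Real.pi_pos.le,
    cpow_sub (x := ((2 : ℝ) : ℂ)) _ _ (by norm_num), cpow_one]
  push_cast; ring

theorem riemannAux_eq_of_re_lt {s : ℂ} (hs : s.re < -1) :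
    riemannAux s = chiFactor s * (riemannZeta (1 - s) - dualAux s) := by
  obtain ⟨hi, he⟩ := riemannAux_eq_integral_Ioi hs
  obtain ⟨hi1, he1⟩ := integral_cpow_mul_gaussSine (s := s) (by linarith)
  have he2 := integral_cpow_div_exp_sub_one (s := s) (by linarith)
  have hsplit : ∀ u : ℝ, 0 < u → (u : ℂ) ^ (-s) * gaussSine 1 (-dirSW * u) - (u : ℂ) ^ (-s) *
      (exp (Real.pi * I * (-dirSW * u) ^ 2) / expDiff (-dirSW * u)) =
      (u : ℂ) ^ (-s) * (1 / (exp (-(2 * Real.pi * I * (-dirSW * u))) - 1)) := by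
    intro u hu
    have hne : expDiff (-dirSW * u) ≠ 0 := by
      intro h
      obtain ⟨n, hn⟩ := expDiff_eq_zero_iff.1 h
      have h1 := congrArg im hn
      rw [neg_dirSW_mul_im] at h1
      simp at h1
      exact hu.ne' h1
    rw [gaussSine_one_eq hne]; ring
  rw [← setIntegral_congr_fun measurableSet_Ioi hsplit, integral_sub hi1 hi, he1] at he2
  rw [he]
  have hchi : dirSW * (exp (-(Real.pi * I * s / 4)) - exp (3 * Real.pi * I * s / 4)) *
      ((2 * Real.pi : ℂ) ^ (s - 1) * exp (-(Real.pi * I / 4) * (s - 1)) * Gamma (1 - s)) =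
      -chiFactor s := by
    -- The phases of the two rays and of the Gamma integral combine into the sine of the factor χ.
    have hsin : dirSW * (exp (-(Real.pi * I * s / 4)) - exp (3 * Real.pi * I * s / 4)) *
        exp (-(Real.pi * I / 4) * (s - 1)) = -(2 * sin (Real.pi * s / 2)) := by
      have hI := Complex.exp_pi_div_two_mul_I
      have t1 : dirSW * exp (-(Real.pi * I * s / 4)) * exp (-(Real.pi * I / 4) * (s - 1)) =
          -(exp (Real.pi / 2 * I) * exp (-(Real.pi * s / 2) * I)) := by
        rw [← neg_neg dirSW, neg_dirSW_eq_exp, neg_mul, neg_mul, ← Complex.exp_add,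
          ← Complex.exp_add, ← Complex.exp_add]
        congr 2; push_cast; ring
      have t2 : dirSW * exp (3 * Real.pi * I * s / 4) * exp (-(Real.pi * I / 4) * (s - 1)) =
          -(exp (Real.pi / 2 * I) * exp ((Real.pi * s / 2) * I)) := by
        rw [← neg_neg dirSW, neg_dirSW_eq_exp, neg_mul, neg_mul, ← Complex.exp_add,
          ← Complex.exp_add, ← Complex.exp_add]
        congr 2; push_cast; ring
      rw [hI] at t1 t2
      rw [Complex.two_sin]
      linear_combination t1 - t2
    rw [chiFactor, two_cpow_mul_pi_cpow]
    linear_combination ((2 * Real.pi : ℂ) ^ (s - 1) * Gamma (1 - s)) * hsin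
  linear_combination (-(dirSW * (exp (-(Real.pi * I * s / 4)) - exp (3 * Real.pi * I * s / 4)))) *
    he2 + (dualAux s - riemannZeta (1 - s)) * hchi

/-! ### Analytic continuation -/

theorem one_sub_ne_neg_natCast {s : ℂ} (hs : 1 - s ∈ slitPlane) (n : ℕ) : 1 - s ≠ -n := by
  intro h
  rw [h, mem_slitPlane_iff] at hs
  simp at hs
  have : (0 : ℝ) ≤ n := n.cast_nonneg
  linarith

theorem riemannZeta_eq_chiFactor_mul {s : ℂ} (hs : 1 - s ∈ slitPlane) (h0 : s ≠ 0) :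
    riemannZeta s = chiFactor s * riemannZeta (1 - s) := by
  have h := riemannZeta_one_sub (one_sub_ne_neg_natCast hs) (by simpa using h0)
  rw [sub_sub_cancel, neg_sub, show Real.pi * (1 - s) / 2 = Real.pi / 2 - Real.pi * s / 2 by ring,
    Complex.cos_pi_div_two_sub] at h
  rw [h, chiFactor, two_cpow_mul_pi_cpow]
  ring

theorem differentiableAt_chiFactor {s : ℂ} (hs : 1 - s ∈ slitPlane) :
    DifferentiableAt ℂ chiFactor s := by
  have hG : DifferentiableAt ℂ (fun s : ℂ => Gamma (1 - s)) s :=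
    (differentiableAt_Gamma (1 - s) (one_sub_ne_neg_natCast hs)).comp s (by fun_prop)
  have h1 : DifferentiableAt ℂ (fun s : ℂ => (2 : ℂ) ^ s) s :=
    differentiableAt_id.const_cpow (Or.inl two_ne_zero)
  have h2 : DifferentiableAt ℂ (fun s : ℂ => (Real.pi : ℂ) ^ (s - 1)) s :=
    (differentiableAt_id.sub_const 1).const_cpow (Or.inl (by exact_mod_cast Real.pi_ne_zero))
  exact ((h1.mul h2).mul (by fun_prop)).mul hG

theorem differentiableAt_riemannZeta_of_slitPlane {s : ℂ} (hs : 1 - s ∈ slitPlane) :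
    DifferentiableAt ℂ riemannZeta s := by
  refine differentiableAt_riemannZeta fun h => ?_
  rw [h, sub_self] at hs
  exact zero_notMem_slitPlane hs

/-- The functional equation linking `riemannAux`, `dualAux` and `riemannZeta`. -/
theorem riemannAux_eq_zeta_sub {s : ℂ} (hs : 1 - s ∈ slitPlane) :
    riemannAux s = riemannZeta s - chiFactor s * dualAux s := by
  -- Writing ζ(s) instead of χ(s) ζ(1-s) avoids the pole at s = 0, so both sides are holomorphic on
  -- the whole connected cut plane and need only agree near -2.
  set U : Set ℂ := {s | 1 - s ∈ slitPlane} with hU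
  have hUo : IsOpen U := isOpen_slitPlane.preimage (by fun_prop)
  have hUc : IsPreconnected U := by
    have h1 : IsPreconnected slitPlane :=
      (starConvex_one_slitPlane.isPathConnected one_mem_slitPlane).isConnected.isPreconnected
    have h2 : U = (fun z : ℂ => 1 - z) '' slitPlane := by
      ext z
      simp only [hU, Set.mem_image]
      exact ⟨fun h => ⟨1 - z, h, by ring⟩, by rintro ⟨w, hw, rfl⟩; simpa [hU] using hw⟩
    rw [h2]
    exact h1.image _ (by fun_prop)
  have hL : AnalyticOnNhd ℂ riemannAux U := differentiable_riemannAux.differentiableOn.analyticOnNhd hUo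
  have hR : AnalyticOnNhd ℂ (fun s => riemannZeta s - chiFactor s * dualAux s) U := by
    refine DifferentiableOn.analyticOnNhd (fun z hz => DifferentiableAt.differentiableWithinAt ?_) hUo
    exact (differentiableAt_riemannZeta_of_slitPlane hz).sub
      ((differentiableAt_chiFactor hz).mul (differentiable_dualAux z))
  have h2U : (-2 : ℂ) ∈ U := by
    simp only [hU, Set.mem_ofPred_eq, mem_slitPlane_iff]; left; norm_num
  refine hL.eqOn_of_preconnected_of_eventuallyEq hR hUc h2U ?_ hs
  have hn : {z : ℂ | z.re < -1} ∈ 𝓝 (-2 : ℂ) :=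
    (isOpen_lt continuous_re continuous_const).mem_nhds (by norm_num)
  filter_upwards [hn] with z hz
  have hz' : z.re < -1 := hz
  have hzU : 1 - z ∈ slitPlane := by
    rw [mem_slitPlane_iff]; left; simp; linarith
  rw [riemannAux_eq_of_re_lt hz, riemannZeta_eq_chiFactor_mul hzU, mul_sub]
  rintro rfl
  norm_num at hz'

/-! ### The expansion around the saddle point -/

theorem log_im_mem_of_re_add_im_pos {x : ℂ} (hx : 0 < x.re + x.im) :
    -(Real.pi / 4) < (log x).im ∧ (log x).im < 3 * Real.pi / 4 := by
  have hre : 0 < (dirSE * x).re := by rw [dirSE_mul_re]; positivity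
  have harg := abs_lt.1 (abs_arg_lt_pi_div_two_iff.2 (Or.inl hre))
  have him : (log (dirSE * x) + (Real.pi / 4 : ℝ) * I).im = arg (dirSE * x) + Real.pi / 4 := by
    simp [log_im]
  rw [log_eq_of_re_add_im_pos hx, him]
  constructor <;> linarith [harg.1, harg.2]

theorem log_div_of_re_add_im_pos {x y : ℂ} (hx : 0 < x.re + x.im) (hy : 0 < y.re + y.im) :
    log (x / y) = log x - log y := by
  have hx0 : x ≠ 0 := by rintro rfl; simp at hx
  have hy0 : y ≠ 0 := by rintro rfl; simp at hy
  have h1 := log_im_mem_of_re_add_im_pos hx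
  have h2 := log_im_mem_of_re_add_im_pos hy
  rw [← log_exp (x := log x - log y) (by rw [sub_im]; linarith [h1.1, h2.2])
    (by rw [sub_im]; linarith [h1.2, h2.1]), Complex.exp_sub, exp_log hx0, exp_log hy0]

/-- Since s - 1 = 2πiη², the linear terms at η cancel and the second-order part of the exponent is
-2πi(x-η)²; w collects the rest. Both x and η lie in one half-plane where log(x/η) = log x - log η.
-/
theorem cpow_mul_gauss_eq {s η x : ℂ} (hη : η ^ 2 = (s - 1) / (2 * Real.pi * I))
    (hη0 : 0 < η.re + η.im) (hx : 0 < x.re + x.im) :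
    x ^ (s - 1) * quadExp 1 0 x = η ^ (s - 1) * exp (-(Real.pi * I * η ^ 2)) *
      (exp (-(2 * Real.pi * I * (x - η) ^ 2)) * (wFun η (x - η) + 1)) := by
  have hx0 : x ≠ 0 := by rintro rfl; simp at hx
  have hη1 : η ≠ 0 := by rintro rfl; simp at hη0
  have hs : s - 1 = 2 * Real.pi * I * η ^ 2 := by
    rw [hη, mul_div_cancel₀ _ Complex.two_pi_I_ne_zero]
  have h1 : 1 + (x - η) / η = x / η := by field_simp; ring
  rw [wFun, sub_add_cancel, quadExp, h1, log_div_of_re_add_im_pos hx hη0, cpow_def_of_ne_zero hx0,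
    cpow_def_of_ne_zero hη1, hs, ← Complex.exp_add, ← Complex.exp_add, ← Complex.exp_add,
    ← Complex.exp_add, ← Complex.exp_add]
  congr 1
  push_cast
  field_simp
  ring

/-- The sum is √2 ‖η‖ cos(arg η - π/4). -/
theorem re_add_im_pos_of_arg {η : ℂ} (h0 : η ≠ 0) (h1 : -(Real.pi / 4) < arg η)
    (h2 : arg η < 3 * Real.pi / 4) : 0 < η.re + η.im := by
  have hc : 0 < Real.cos (arg η - Real.pi / 4) :=
    Real.cos_pos_of_mem_Ioo ⟨by linarith, by linarith⟩
  rw [Real.cos_sub, Real.cos_pi_div_four, Real.sin_pi_div_four] at hc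
  rw [← norm_mul_cos_arg η, ← norm_mul_sin_arg η, ← mul_add]
  have hr : 0 < Real.sqrt 2 / 2 := by positivity
  refine mul_pos (norm_pos_iff.2 h0) ?_
  by_contra! h
  nlinarith

/-! ### Residues at the integers and the exact expansion of the reflected integral -/

theorem quadExp_one_zero_intCast (n : ℤ) : quadExp 1 0 n = (-1) ^ n := by
  have h1 : quadExp 1 0 n = (exp (((n ^ 2 : ℤ) : ℂ) * (Real.pi * I)))⁻¹ := by
    rw [quadExp, ← Complex.exp_add, ← Complex.exp_neg]
    congr 1; push_cast; ring
  rw [h1, Complex.exp_int_mul, exp_pi_mul_I]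
  rcases n.even_or_odd with h | h
  · rw [h.neg_one_zpow, (Even.pow_of_ne_zero h two_ne_zero).neg_one_zpow, inv_one]
  · rw [h.neg_one_zpow, h.pow.neg_one_zpow]; norm_num

theorem strip_norm_ge {n : ℤ} (hn : 1 ≤ n) {x : ℂ} (hx : |x.re + x.im - n| ≤ 1 / 2) :
    1 / 4 ≤ ‖x‖ := by
  have : (1 : ℝ) ≤ n := by exact_mod_cast hn
  exact norm_ge_of_re_add_im (by linarith [(abs_le.1 hx).1])

theorem dualIntegral_sub (s : ℂ) {n : ℤ} (hn : 1 ≤ n) :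
    lineIntegral (fun x => x ^ (s - 1) * quadExp 1 0 x / expDiff x) (n - 1 / 2) dirSE -
      lineIntegral (fun x => x ^ (s - 1) * quadExp 1 0 x / expDiff x) (n + 1 / 2) dirSE =
      (n : ℂ) ^ (s - 1) := by
  have hn' : (1 : ℝ) ≤ n := by exact_mod_cast hn
  rw [lineIntegral_sub_eq_apply_intCast n (φ := fun x => x ^ (s - 1) * quadExp 1 0 x) ?_
    ((GaussDomOn.quadExp_strip le_rfl 0 n).cpow_mul (fun x hx => strip_norm_ge hn hx) _)]
  · have hs : ((-1 : ℂ) ^ n) * (-1) ^ n = 1 := by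
      rw [← mul_zpow]; simp
    rw [quadExp_one_zero_intCast]
    linear_combination (n : ℂ) ^ (s - 1) * hs
  · intro x hx
    have hx' : |x.re + x.im - n| < 1 := hx
    have hslit : x ∈ slitPlane := by
      rw [mem_slitPlane_iff]
      by_contra! h
      linarith [(abs_lt.1 hx').1, h.1, h.2]
    exact ((differentiableAt_id.cpow_const hslit).mul
      (differentiable_quadExp 1 0 x)).differentiableWithinAt

theorem gauss_eq_quadExp (η x : ℂ) : exp (-(2 * Real.pi * I * (x - η) ^ 2)) =
    exp (-(2 * Real.pi * I * η ^ 2)) * quadExp 2 (2 * η) x := by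
  rw [quadExp, ← Complex.exp_add, ← Complex.exp_add]
  congr 1; push_cast; ring

theorem gaussIntegral_sub (η : ℂ) (n : ℤ) :
    lineIntegral (fun x => exp (-(2 * Real.pi * I * (x - η) ^ 2)) / expDiff x) (n - 1 / 2) dirSE -
      lineIntegral (fun x => exp (-(2 * Real.pi * I * (x - η) ^ 2)) / expDiff x) (n + 1 / 2) dirSE =
      (-1) ^ n * exp (-(2 * Real.pi * I * (n - η) ^ 2)) := by
  refine lineIntegral_sub_eq_apply_intCast n (φ := fun x => exp (-(2 * Real.pi * I * (x - η) ^ 2)))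
    (by fun_prop) ?_
  simp only [gauss_eq_quadExp]
  exact (GaussDomOn.quadExp_strip one_le_two (2 * η) n).const_mul _

theorem line_re_add_im_pos {m : ℤ} (hm : 0 ≤ m) (u : ℝ) :
    1 / 2 ≤ (m + 1 / 2 + u * dirSE : ℂ).re + (m + 1 / 2 + u * dirSE : ℂ).im := by
  have h := add_mul_dirSE_re_add_im (m + 1 / 2) u
  push_cast at h
  have : (0 : ℝ) ≤ m := by exact_mod_cast hm
  rw [h]; linarith

theorem integrable_dualIntegrand (s : ℂ) {m : ℤ} (hm : 0 ≤ m) : Integrable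
    (lineIntegrand (fun x => x ^ (s - 1) * quadExp 1 0 x / expDiff x) (m + 1 / 2) dirSE) := by
  have hd : GaussDomOn (quadExp 1 0) (Set.range fun u : ℝ => (m + 1 / 2 + u * dirSE : ℂ)) := by
    refine (gaussDomOn_quadExp le_rfl 0 |(m + 1 / 2 : ℝ)|).mono ?_
    rintro _ ⟨u, rfl⟩
    have h := add_mul_dirSE_re_add_im (m + 1 / 2) u
    push_cast at h
    simp only [Set.mem_ofPred_eq, h, le_refl]
  refine integrable_lineIntegrand_of_gaussDom (Or.inl rfl) m
    (φ := fun x => x ^ (s - 1) * quadExp 1 0 x)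
    ((hd.cpow_mul ?_ (s - 1)).line (m + 1 / 2) norm_dirSE fun u => ⟨u, rfl⟩) ?_
  · rintro _ ⟨u, rfl⟩
    exact norm_ge_of_re_add_im (line_re_add_im_pos hm u)
  · refine Continuous.mul (continuous_iff_continuousAt.2 fun u => ?_)
      ((differentiable_quadExp 1 0).continuous.comp (by fun_prop))
    refine ContinuousAt.cpow (by fun_prop) (by fun_prop) ?_
    have := line_re_add_im_pos hm u
    rw [mem_slitPlane_iff]
    by_contra! h
    linarith [h.1, h.2]

theorem integrable_gaussIntegrand (η : ℂ) (m : ℤ) : Integrable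
    (lineIntegrand (fun x => exp (-(2 * Real.pi * I * (x - η) ^ 2)) / expDiff x)
      (m + 1 / 2) dirSE) := by
  refine ((integrable_quadExp_div one_le_two (2 * η) m).const_mul
    (exp (-(2 * Real.pi * I * η ^ 2)))).congr (Eventually.of_forall fun u => ?_)
  simp only [lineIntegrand, gauss_eq_quadExp]
  ring

theorem lineIntegrand_dual_sub {s η : ℂ} (hη : η ^ 2 = (s - 1) / (2 * Real.pi * I))
    (hη0 : 0 < η.re + η.im) {m : ℤ} (hm : 0 ≤ m) (u : ℝ) :
    lineIntegrand (fun x => x ^ (s - 1) * quadExp 1 0 x / expDiff x) (m + 1 / 2) dirSE u =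
      η ^ (s - 1) * exp (-(Real.pi * I * η ^ 2)) *
      (lineIntegrand (fun x => exp (-(2 * Real.pi * I * (x - η) ^ 2)) / expDiff x)
        (m + 1 / 2) dirSE u + lineIntegrand (remIntegrand η) (m + 1 / 2) dirSE u) := by
  have hx := line_re_add_im_pos hm u
  have e : ∀ x, remIntegrand η x =
    exp (-(2 * Real.pi * I * (x - η) ^ 2)) / expDiff x * wFun η (x - η) := fun x => rfl
  simp only [lineIntegrand, e]
  rw [cpow_mul_gauss_eq hη hη0 (by linarith)]
  ring

/-- Up to a nonzero factor the remainder is the full integrand minus its Gaussian part, both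
integrable, so w needs no estimate. -/
theorem integrable_remIntegrand {s η : ℂ} (hη : η ^ 2 = (s - 1) / (2 * Real.pi * I))
    (hη0 : 0 < η.re + η.im) {m : ℤ} (hm : 0 ≤ m) :
    Integrable (lineIntegrand (remIntegrand η) (m + 1 / 2) dirSE) := by
  have hη1 : η ≠ 0 := by rintro rfl; simp at hη0
  have hC : η ^ (s - 1) * exp (-(Real.pi * I * η ^ 2)) ≠ 0 :=
    mul_ne_zero (by rw [cpow_def_of_ne_zero hη1]; exact exp_ne_zero _) (exp_ne_zero _)
  refine (((integrable_dualIntegrand s hm).const_mul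
    (η ^ (s - 1) * exp (-(Real.pi * I * η ^ 2)))⁻¹).sub (integrable_gaussIntegrand η m)).congr
    (Eventually.of_forall fun u => ?_)
  simp only [Pi.sub_apply]
  rw [lineIntegrand_dual_sub hη hη0 hm, inv_mul_cancel_left₀ hC, add_sub_cancel_left]

theorem dualIntegral_eq {s η : ℂ} (hη : η ^ 2 = (s - 1) / (2 * Real.pi * I))
    (hη0 : 0 < η.re + η.im) {m : ℤ} (hm : 0 ≤ m) :
    lineIntegral (fun x => x ^ (s - 1) * quadExp 1 0 x / expDiff x) (m + 1 / 2) dirSE =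
      η ^ (s - 1) * exp (-(Real.pi * I * η ^ 2)) * (riemannTerm m η + remainderR η m) := by
  rw [riemannTerm_eq, remainderR, lineIntegral, lineIntegral, lineIntegral,
    ← integral_add (integrable_gaussIntegrand η m) (integrable_remIntegrand hη hη0 hm),
    ← integral_const_mul]
  exact integral_congr_ae (Eventually.of_forall (lineIntegrand_dual_sub hη hη0 hm))

theorem dualAux_eq_sum_add (s : ℂ) {m : ℤ} (hm : 0 ≤ m) : dualAux s =
    ∑ n ∈ Finset.Icc 1 m, (n : ℂ) ^ (s - 1) +
      lineIntegral (fun x => x ^ (s - 1) * quadExp 1 0 x / expDiff x) (m + 1 / 2) dirSE := by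
  induction m, hm using Int.leInduction with
  | base => simp [dualAux]
  | succ k hk ih =>
    have h := dualIntegral_sub s (n := k + 1) (by omega)
    rw [show (((k + 1 : ℤ) : ℂ) - 1 / 2) = k + 1 / 2 by push_cast; ring] at h
    have hI : Finset.Icc 1 (k + 1) = insert (k + 1) (Finset.Icc 1 k) := by
      ext j; simp only [Finset.mem_insert, Finset.mem_Icc]; omega
    rw [ih, hI, Finset.sum_insert (by simp)]
    linear_combination h

/-- The value does not depend on k: at k = m the w-sum is empty, and each increase of k adds three
contributions that cancel. -/
theorem siegelPart_eq_dualAux {s η : ℂ} (hη : η ^ 2 = (s - 1) / (2 * Real.pi * I))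
    (hη0 : 0 < η.re + η.im) {m k : ℤ} (hm : 0 ≤ m) (hk : m ≤ k) :
    siegelPart s η m k = dualAux s := by
  induction k, hk using Int.leInduction with
  | base =>
    rw [dualAux_eq_sum_add s hm, dualIntegral_eq hη hη0 hm, siegelPart]
    simp
  | succ k hk ih =>
    rw [← ih, siegelPart, siegelPart, riemannTerm_eq, riemannTerm_eq]
    have h := gaussIntegral_sub η (k + 1)
    rw [show (((k + 1 : ℤ) : ℂ) - 1 / 2) = k + 1 / 2 by push_cast; ring] at h
    have hI : ∀ a : ℤ, a ≤ k + 1 → Finset.Icc a (k + 1) = insert (k + 1) (Finset.Icc a k) := by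
      intro a ha
      ext j; simp only [Finset.mem_insert, Finset.mem_Icc]; omega
    have hx : 0 < ((k + 1 : ℤ) : ℂ).re + ((k + 1 : ℤ) : ℂ).im := by
      rw [intCast_re, intCast_im, add_zero]
      exact_mod_cast (by omega : 0 < k + 1)
    have hw := cpow_mul_gauss_eq hη hη0 hx
    rw [quadExp_one_zero_intCast] at hw
    have hs : ((-1 : ℂ) ^ (k + 1)) * (-1) ^ (k + 1) = 1 := by
      rw [← mul_zpow]; simp
    have hs1 : (-1 : ℂ) ^ (k + 1 - 1) = -(-1) ^ (k + 1) := by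
      rw [zpow_sub_one₀ (by norm_num)]; norm_num
    rw [hI 1 (by omega), hI (m + 1) (by omega), Finset.sum_insert (by simp),
      Finset.sum_insert (by simp), hs1]
    -- The new power is the full residue at k + 1, proportional to 1 + w; the jump of the Gaussian
    -- integral removes the 1 and the new summand removes the w.
    linear_combination (-1) ^ (k + 1) * hw - ((k + 1 : ℤ) : ℂ) ^ (s - 1) * hs -
      η ^ (s - 1) * exp (-(Real.pi * I * η ^ 2)) * h

end

/-! ### The theorem -/

theorem mainTheorem7 (s η : ℂ) (hs : s.im ≠ 0 ∨ s.re < 1)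
    (hη : η ^ 2 = (s - 1) / (2 * Real.pi * Complex.I))
    (hη1 : -(Real.pi / 4) < arg η) (hη2 : arg η < 3 * Real.pi / 4)
    (m k : ℤ) (hm : m = ⌊η.re + η.im⌋) (hk : m ≤ k) :
    Integrable (lineIntegrand (auxIntegrand s) (1 / 2) dirSW) ∧
    Integrable (lineIntegrand (remIntegrand η) (m + 1 / 2) dirSE) ∧
    Tendsto (riemannQuot k) (𝓝[≠] η) (𝓝 (riemannTerm k η)) ∧
    (s ≠ 0 → riemannAux s = chiFactor s * (riemannZeta (1 - s) - siegelPart s η m k)) ∧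
    (s = 0 → Tendsto (fun z => chiFactor z * (riemannZeta (1 - z) - siegelPart s η m k))
      (𝓝[≠] s) (𝓝 (riemannAux s))) := by
  have hU : 1 - s ∈ slitPlane := by
    rw [mem_slitPlane_iff]
    rcases hs with h | h
    · right; simpa using h
    · left; simpa using h
  -- The bounds on the argument do not exclude 0, since `arg 0 = 0`; it is excluded because s ≠ 1.
  have hη0 : η ≠ 0 := by
    rintro rfl
    have h1 : s - 1 = 0 := by
      have := hη.symm
      rw [zero_pow two_ne_zero, div_eq_zero_iff] at this
      exact this.resolve_right Complex.two_pi_I_ne_zero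
    rw [← neg_sub, h1, neg_zero] at hU
    exact zero_notMem_slitPlane hU
  have hpos := re_add_im_pos_of_arg hη0 hη1 hη2
  have hm0 : 0 ≤ m := by rw [hm]; exact Int.floor_nonneg.2 hpos.le
  have hsp := siegelPart_eq_dualAux hη hpos hm0 hk
  refine ⟨integrable_auxIntegrand s, integrable_remIntegrand hη hpos hm0, ?_, fun h0 => ?_,
    fun h0 => ?_⟩
  · rw [riemannTerm_eq]; exact tendsto_riemannQuot k η
  · rw [hsp, riemannAux_eq_zeta_sub hU, riemannZeta_eq_chiFactor_mul hU h0, mul_sub]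
  · rw [hsp, riemannAux_eq_zeta_sub hU]
    -- For z ≠ 0 near 0, χ(z) ζ(1-z) is ζ(z), which is continuous at 0; the subtracted part stays
    -- frozen at s.
    have hc : ContinuousAt (fun z => riemannZeta z - chiFactor z * dualAux s) s :=
      (differentiableAt_riemannZeta_of_slitPlane hU).continuousAt.sub
        ((differentiableAt_chiFactor hU).continuousAt.mul continuousAt_const)
    have hUo : IsOpen {z : ℂ | 1 - z ∈ slitPlane} := isOpen_slitPlane.preimage (by fun_prop)
    have hUn : ∀ᶠ z in 𝓝[≠] s, 1 - z ∈ slitPlane := mem_nhdsWithin_of_mem_nhds (hUo.mem_nhds hU)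
    refine (hc.tendsto.mono_left nhdsWithin_le_nhds).congr' ?_
    filter_upwards [hUn, self_mem_nhdsWithin] with z hz hzs
    rw [riemannZeta_eq_chiFactor_mul hz (by rw [← h0]; exact hzs), mul_sub]
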